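/- Let $X(t)$, $t\ge 0$, be an irreducible continuous-time Markov chain on $\{1,\dots,K\}$ with right-continuous paths, arbitrary initial distribution, generator $Q=(q_{ij})$ with strictly negative diagonal entries (so $K\ge 2$), and stationary distribution $\pi$ (a probability vector with $\pi Q=0$). Let $\sigma_i=\sum_{j\ne i}q_{ij}$ be the total exit rate of state $i$. For $\lambda>0$ let the chain be sampled at the points of a Poisson process of intensity $\lambda$ that is independent of $X$. In the fresh-when-sampled model, the binary freshness process $F_s(t)$ is set to $1$ whenever a sample is taken and stays $1$ until the next transition of $X$, at which instant it becomes $0$ and stays $0$ until the next sample; its initial value $F_s(0)\in\{0,1\}$ is an arbitrary random variable. Then, for every $\lambda>0$, the steady-state mean freshness $f(\lambda)=\mathbb{E}[F_s]$ exists, both as the almost sure time average $\lim_{\tau\to\infty}\frac1\tau\int_0^\tau F_s(t)\,dt$ and as the limit $\lim_{t\to\infty}\mathbb{P}[F_s(t)=1]$, and $$f(\lambda)=1-\sum_{i=1}^K\frac{\pi_i\sigma_i}{\lambda+\sigma_i}.$$ Moreover, as a function of $\lambda\in(0,\infty)$, $f$ is strictly increasing and strictly concave, it is differentiable with continuous derivative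 $f'$, and $\lim_{\lambda\to 0^+}f(\lambda)=0$. -/

import Mathlib

open MeasureTheory ProbabilityTheory Filter Topology Set
open scoped NNReal ENNReal

namespace PoissonSampling

/-- `Q` is the infinitesimal generator of a continuous-time Markov chain without absorbing states:
nonnegative transition rates off the diagonal, strictly negative diagonal, zero row sums. -/
structure IsGenerator {K : ℕ} (Q : Matrix (Fin K) (Fin K) ℝ) : Prop where
  offDiag_nonneg : ∀ i j, i ≠ j → 0 ≤ Q i j
  diag_neg : ∀ i, Q i i < 0
  row_sum : ∀ i, ∑ j, Q i j = 0

/-- The total rate `σ_i = ∑_{j ≠ i} q_{ij}` out of state `i`. -/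
def exitRate {K : ℕ} (Q : Matrix (Fin K) (Fin K) ℝ) (i : Fin K) : ℝ :=
  ∑ j ∈ Finset.univ.erase i, Q i j

/-- The transition matrix `exp (t Q)` over a time interval of length `t`. -/
noncomputable def transition {K : ℕ} (Q : Matrix (Fin K) (Fin K) ℝ) (t : ℝ) :
    Matrix (Fin K) (Fin K) ℝ :=
  NormedSpace.exp (t • Q)

/-- Every state can be reached from every state, with positive probability, in some finite time. -/
def IsIrreducible {K : ℕ} (Q : Matrix (Fin K) (Fin K) ℝ) : Prop :=
  ∀ i j, ∃ t : ℝ≥0, 0 < transition Q t i j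

/-- `π` is a stationary distribution: a probability vector with `π Q = 0`. -/
structure IsStationary {K : ℕ} (Q : Matrix (Fin K) (Fin K) ℝ) (π : Fin K → ℝ) : Prop where
  nonneg : ∀ i, 0 ≤ π i
  sum_eq_one : ∑ i, π i = 1
  balance : ∀ j, ∑ i, π i * Q i j = 0

/-- `X` is a continuous-time Markov chain with generator `Q` (and arbitrary initial law): it has
right-continuous paths (for the discrete topology of the state space), and its finite-dimensional
laws are those of the Markov chain with transition matrices `exp (t Q)`. -/
structure IsCTMC {K : ℕ} {Ω : Type*} [MeasurableSpace Ω] (Q : Matrix (Fin K) (Fin K) ℝ)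
    (X : ℝ≥0 → Ω → Fin K) (μ : Measure Ω) : Prop where
  measurable : ∀ t, Measurable (X t)
  rightContinuous : ∀ ω t, ContinuousWithinAt (fun s => X s ω) (Ici t) t
  markov : ∀ (n : ℕ) (t : Fin (n + 1) → ℝ≥0), Monotone t → ∀ x : Fin (n + 1) → Fin K,
    μ.real {ω | ∀ k, X (t k) ω = x k} =
      μ.real {ω | X (t 0) ω = x 0} *
        ∏ k : Fin n, transition Q ((t k.succ : ℝ) - t k.castSucc) (x k.castSucc) (x k.succ)

/-- `N` is (the counting process of) a Poisson process of intensity `lam`. -/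
structure IsPoissonProcess {Ω : Type*} [MeasurableSpace Ω] (lam : ℝ≥0)
    (N : ℝ≥0 → Ω → ℕ) (μ : Measure Ω) : Prop where
  measurable : ∀ t, Measurable (N t)
  zero : ∀ ω, N 0 ω = 0
  monotone : ∀ ω, Monotone (fun t => N t ω)
  rightContinuous : ∀ ω t, ContinuousWithinAt (fun s => N s ω) (Ici t) t
  indepIncrements : HasIndepIncrements N μ
  law : ∀ s t, s ≤ t → μ.map (fun ω => N t ω - N s ω) = poissonMeasure (lam * (t - s))

/-- A Markov source `X` with generator `Q`, sampled at the points of an independent Poisson process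
with counting process `N` and intensity `lam`. -/
structure IsPoissonSampled {K : ℕ} {Ω : Type*} [MeasurableSpace Ω]
    (Q : Matrix (Fin K) (Fin K) ℝ) (lam : ℝ≥0) (X : ℝ≥0 → Ω → Fin K) (N : ℝ≥0 → Ω → ℕ)
    (μ : Measure Ω) : Prop where
  source : IsCTMC Q X μ
  sampler : IsPoissonProcess lam N μ
  indep : IndepFun (fun ω t => X t ω) (fun ω t => N t ω) μ

/-- The path `x` jumps at time `t`. (A right-continuous path never does so at time `0`.) -/
def JumpsAt {S : Type*} [TopologicalSpace S] (x : ℝ≥0 → S) (t : ℝ≥0) : Prop :=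
  ¬ ContinuousAt x t

/-- Freshness at time `t`, for a source path `x`, a path `n` counting the samples, and the
initial freshness bit `b`: either a sample was taken at some time `s ≤ t` and the source has made no
transition in `(s, t]`, or the information was initially fresh and the source has made no transition
in `(0, t]`. -/
def IsFresh {K : ℕ} (x : ℝ≥0 → Fin K) (n : ℝ≥0 → ℕ) (b : Bool) (t : ℝ≥0) : Prop :=
  (∃ s ≤ t, JumpsAt n s ∧ ∀ u ∈ Ioc s t, ¬ JumpsAt x u) ∨
    (b = true ∧ ∀ u ∈ Ioc 0 t, ¬ JumpsAt x u)

open Classical in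
/-- The binary freshness process `F_s(t)` of the fresh-when-sampled model. -/
noncomputable def freshness {K : ℕ} {Ω : Type*} (X : ℝ≥0 → Ω → Fin K) (N : ℝ≥0 → Ω → ℕ)
    (b : Ω → Bool) (t : ℝ≥0) (ω : Ω) : ℝ :=
  if IsFresh (fun s => X s ω) (fun s => N s ω) (b ω) t then 1 else 0

/-- The binary process `F` has mean freshness `m` in the steady state: `m` is the almost sure
long-run time average of `F`, and the limit of the probabilities `ℙ[F(t) = 1]`. -/
structure HasMeanFreshness {Ω : Type*} [MeasurableSpace Ω] (μ : Measure Ω)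
    (F : ℝ≥0 → Ω → ℝ) (m : ℝ) : Prop where
  timeAverage : ∀ᵐ ω ∂μ,
    Tendsto (fun T : ℝ => T⁻¹ * ∫ t in (0 : ℝ)..T, F t.toNNReal ω) atTop (𝓝 m)
  steadyState : Tendsto (fun t : ℝ≥0 => μ.real {ω | F t ω = 1}) atTop (𝓝 m)

end PoissonSampling

/-! Time is discretised. On the grid `k δ`, `gridFresh` sets the bit when a cell contains a sample
and otherwise keeps it exactly when the states at the two ends of the cell agree. The source is
Markov, the Poisson increments are independent, and the two processes are independent of each other;
hence the next cell can be conditioned on the whole grid history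
(`IsPoissonSampled.measureReal_step`), and the probability of being fresh in state `i` follows a
scalar affine recursion with factor `e^{-λδ} P_ii(δ)`. A Doeblin argument
(`exists_abs_transition_sub_le`) makes the law of the state converge to `π`. So, on any event of the
past, the probability of freshness approaches `gridMean` exponentially fast in elapsed time, with
constants that do not depend on `δ` (`IsGridMixing`). As `δ → 0`, `gridMean` tends to `∑ λ π_i / (λ
+ σ_i)`, which is the claimed formula (`tendsto_gridMean`).

Excursions inside a cell escape the grid, but paths are right-continuous with discrete values, so at
each fixed time the grid bit equals the true bit once the mesh is fine enough
(`eventually_gridFresh_iff`). Dominated convergence then carries the uniform bounds to continuous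
time. The limit of the probabilities follows directly. For the time average, mixing bounds
covariances, so the mean square deviation over `[0, T]` is `O(1/T)`; this is summable along `T = (n
+ 1)²`, and monotonicity of the integral fills the gaps.

All this is done for initially stale information. The initial bit is forgotten at the first sample,
which almost surely arrives. Monotonicity, concavity, smoothness and the limit at `0` are read off
the formula. -/

namespace PoissonSampling

/-! ### Transition matrices: positivity, stationarity, geometric ergodicity -/

section Transition

open scoped Matrix.Norms.Operator

variable {K : ℕ} {Q : Matrix (Fin K) (Fin K) ℝ}

theorem hasDerivAt_transition_apply (Q : Matrix (Fin K) (Fin K) ℝ) (t : ℝ) (i j : Fin K) :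
    HasDerivAt (fun u => transition Q u i j) ((Q * transition Q t) i j) t := by
  have h := hasDerivAt_exp_smul_const' (𝕂 := ℝ) Q t
  exact (LinearMap.toContinuousLinearMap (Matrix.entryLinearMap ℝ ℝ i j)).hasFDerivAt.comp_hasDerivAt
    t h

theorem hasDerivAt_transition_apply' (Q : Matrix (Fin K) (Fin K) ℝ) (t : ℝ) (i j : Fin K) :
    HasDerivAt (fun u => transition Q u i j) ((transition Q t * Q) i j) t := by
  have h := hasDerivAt_exp_smul_const (𝕂 := ℝ) Q t
  exact (LinearMap.toContinuousLinearMap (Matrix.entryLinearMap ℝ ℝ i j)).hasFDerivAt.comp_hasDerivAt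
    t h

@[simp]
theorem transition_zero (Q : Matrix (Fin K) (Fin K) ℝ) : transition Q 0 = 1 := by
  simp [transition]

theorem transition_add (Q : Matrix (Fin K) (Fin K) ℝ) (s t : ℝ) :
    transition Q (s + t) = transition Q s * transition Q t := by
  rw [transition, add_smul, Matrix.exp_add_of_commute]
  · rfl
  · exact ((Commute.refl Q).smul_left s).smul_right t

/-- Only the zeroth term of the exponential series is kept; the others are nonnegative. -/
theorem one_apply_le_exp_apply {M : Matrix (Fin K) (Fin K) ℝ} (hM : ∀ i j, 0 ≤ M i j)
    (i j : Fin K) : (1 : Matrix (Fin K) (Fin K) ℝ) i j ≤ NormedSpace.exp M i j := by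
  have hpow : ∀ n : ℕ, ∀ i j, 0 ≤ (M ^ n) i j := by
    intro n
    induction n with
    | zero => intro i j; rw [pow_zero, Matrix.one_apply]; split_ifs <;> norm_num
    | succ n ih =>
      intro i j
      rw [pow_succ, Matrix.mul_apply]
      exact Finset.sum_nonneg fun k _ => mul_nonneg (ih i k) (hM k j)
  have h := (NormedSpace.exp_series_hasSum_exp' (𝕂 := ℝ) M).mapL
    (LinearMap.toContinuousLinearMap (Matrix.entryLinearMap ℝ ℝ i j))
  have h0 := le_hasSum h 0 fun n _ => by
    simpa using mul_nonneg (by positivity) (hpow n i j)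
  simp at h0
  exact h0

/-- Once `c` dominates every `|Q i i|`, the matrix `Q + c • 1` is entrywise nonnegative, and
splitting off the commuting scalar part costs only the factor `e^{-tc}`. Nonnegativity of all
entries and positivity of the diagonal both come from this bound. -/
theorem exists_exp_mul_one_apply_le_transition_apply (hQ : IsGenerator Q) :
    ∃ c : ℝ, ∀ t : ℝ, 0 ≤ t → ∀ i j,
      Real.exp (-(t * c)) * (1 : Matrix (Fin K) (Fin K) ℝ) i j ≤ transition Q t i j := by
  set c : ℝ := ∑ i, |Q i i| with hc
  refine ⟨c, fun t ht i j => ?_⟩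
  have hsplit : transition Q t =
      NormedSpace.exp (t • (Q + c • (1 : Matrix (Fin K) (Fin K) ℝ))) *
        NormedSpace.exp ((-(t * c)) • (1 : Matrix (Fin K) (Fin K) ℝ)) := by
    rw [← Matrix.exp_add_of_commute]
    · rw [transition, smul_add, smul_smul, add_assoc, ← add_smul]
      simp
    · exact (Commute.one_right _).smul_right _
  have hdiag : NormedSpace.exp ((-(t * c)) • (1 : Matrix (Fin K) (Fin K) ℝ)) =
      Real.exp (-(t * c)) • (1 : Matrix (Fin K) (Fin K) ℝ) := by
    rw [Matrix.smul_one_eq_diagonal, Matrix.exp_diagonal, Matrix.smul_one_eq_diagonal]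
    congr 1
    ext k
    rw [Pi.exp_def, Real.exp_eq_exp_ℝ]
  rw [hsplit, hdiag, Matrix.mul_smul, mul_one, Matrix.smul_apply, smul_eq_mul]
  refine mul_le_mul_of_nonneg_left (one_apply_le_exp_apply (fun k l => ?_) i j) (Real.exp_nonneg _)
  rw [Matrix.smul_apply, Matrix.add_apply, Matrix.smul_apply, smul_eq_mul, smul_eq_mul]
  refine mul_nonneg ht ?_
  by_cases hkl : k = l
  · subst hkl
    have := Finset.single_le_sum (f := fun i => |Q i i|) (fun i _ => abs_nonneg _)
      (Finset.mem_univ k)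
    simp only [Matrix.one_apply_eq, mul_one]
    have := neg_abs_le (Q k k)
    linarith
  · simpa [Matrix.one_apply_ne hkl] using hQ.offDiag_nonneg k l hkl

theorem transition_nonneg (hQ : IsGenerator Q) {t : ℝ} (ht : 0 ≤ t) (i j : Fin K) :
    0 ≤ transition Q t i j := by
  obtain ⟨c, hc⟩ := exists_exp_mul_one_apply_le_transition_apply hQ
  refine le_trans (mul_nonneg (Real.exp_nonneg _) ?_) (hc t ht i j)
  rw [Matrix.one_apply]; split_ifs <;> norm_num

theorem transition_apply_self_pos (hQ : IsGenerator Q) {t : ℝ} (ht : 0 ≤ t) (i : Fin K) :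
    0 < transition Q t i i := by
  obtain ⟨c, hc⟩ := exists_exp_mul_one_apply_le_transition_apply hQ
  refine lt_of_lt_of_le ?_ (hc t ht i i)
  simpa using Real.exp_pos _

theorem sum_transition (hQ : IsGenerator Q) (t : ℝ) (i : Fin K) :
    ∑ j, transition Q t i j = 1 := by
  have hd : ∀ u, HasDerivAt (fun u => ∑ j, transition Q u i j) 0 u := by
    intro u
    have h := HasDerivAt.fun_sum (u := Finset.univ)
      fun j _ => hasDerivAt_transition_apply' Q u i j
    refine h.congr_deriv ?_
    simp_rw [Matrix.mul_apply]
    rw [Finset.sum_comm]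
    simp [← Finset.mul_sum, hQ.row_sum]
  have h := is_const_of_deriv_eq_zero (fun u => (hd u).differentiableAt) (fun u => (hd u).deriv) t 0
  rw [h]
  simp [Matrix.one_apply]

theorem IsStationary.sum_mul_transition {π : Fin K → ℝ} (hπ : IsStationary Q π) (t : ℝ)
    (j : Fin K) : ∑ i, π i * transition Q t i j = π j := by
  have hd : ∀ u, HasDerivAt (fun u => ∑ i, π i * transition Q u i j) 0 u := by
    intro u
    have h := HasDerivAt.fun_sum (u := Finset.univ)
      fun i _ => (hasDerivAt_transition_apply Q u i j).const_mul (π i)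
    refine h.congr_deriv ?_
    simp_rw [Matrix.mul_apply, Finset.mul_sum]
    rw [Finset.sum_comm]
    simp [← mul_assoc, ← Finset.sum_mul, hπ.balance]
  have h := is_const_of_deriv_eq_zero (fun u => (hd u).differentiableAt) (fun u => (hd u).deriv) t 0
  rw [h]
  simp [Matrix.one_apply]

theorem transition_le_one (hQ : IsGenerator Q) {t : ℝ} (ht : 0 ≤ t) (i j : Fin K) :
    transition Q t i j ≤ 1 := by
  rw [← sum_transition hQ t i]
  exact Finset.single_le_sum (fun k _ => transition_nonneg hQ ht i k) (Finset.mem_univ j)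

theorem transition_mul_le_transition_add (hQ : IsGenerator Q) {s t : ℝ} (hs : 0 ≤ s) (ht : 0 ≤ t)
    (i j k : Fin K) :
    transition Q s i k * transition Q t k j ≤ transition Q (s + t) i j := by
  rw [transition_add, Matrix.mul_apply]
  exact Finset.single_le_sum (f := fun k => transition Q s i k * transition Q t k j)
    (fun l _ => mul_nonneg (transition_nonneg hQ hs i l) (transition_nonneg hQ ht l j))
    (Finset.mem_univ k)

/-- An irreducible chain has strictly positive transition probabilities at a common time. -/
theorem IsIrreducible.exists_transition_pos (hQ : IsGenerator Q) (hirr : IsIrreducible Q) :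
    ∃ T : ℝ, 0 < T ∧ ∀ i j, 0 < transition Q T i j := by
  choose τ hτ using hirr
  -- This time exceeds every `τ i j`. The remaining time is spent returning from `j` to `j`, which
  -- has positive probability.
  refine ⟨(∑ i, ∑ j, (τ i j : ℝ)) + 1, by positivity, fun i j => ?_⟩
  have hle : (τ i j : ℝ) ≤ ∑ i, ∑ j, (τ i j : ℝ) := by
    refine le_trans ?_ (Finset.single_le_sum (f := fun i => ∑ j, (τ i j : ℝ))
      (fun i _ => by positivity) (Finset.mem_univ i))
    exact Finset.single_le_sum (f := fun j => (τ i j : ℝ)) (fun i _ => by positivity)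
      (Finset.mem_univ j)
  have h := transition_mul_le_transition_add hQ (τ i j).coe_nonneg
    (t := (∑ i, ∑ j, (τ i j : ℝ)) + 1 - τ i j) (by linarith) i j j
  rw [add_sub_cancel] at h
  exact lt_of_lt_of_le (mul_pos (hτ i j) (transition_apply_self_pos hQ (by linarith) j)) h

/-- A stochastic matrix with entries at least `ε` contracts the oscillation of functions. -/
theorem sum_mul_sub_sum_mul_le_of_stochastic {P : Matrix (Fin K) (Fin K) ℝ} {ε d : ℝ}
    (hε : ∀ i j, ε ≤ P i j) (h0 : ∀ i j, 0 ≤ P i j) (h1 : ∀ i, ∑ j, P i j = 1)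
    {v : Fin K → ℝ} (hv : ∀ a b, v a - v b ≤ d) (a b : Fin K) :
    ∑ c, P a c * v c - ∑ c, P b c * v c ≤ (1 - ε) * d := by
  -- Values are measured from the minimum of `v`: row `b` then contributes at least `0`, and row `a`
  -- loses its mass at the minimiser, which is at least `ε`.
  obtain ⟨m, -, hm⟩ := Finset.exists_min_image Finset.univ v ⟨a, Finset.mem_univ a⟩
  have hd : 0 ≤ d := by simpa using hv a a
  have hshift : ∀ a, ∑ c, P a c * v c = v m + ∑ c, P a c * (v c - v m) := by
    intro a
    simp_rw [mul_sub, Finset.sum_sub_distrib, ← Finset.sum_mul, h1]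
    ring
  have hlow : 0 ≤ ∑ c, P b c * (v c - v m) :=
    Finset.sum_nonneg fun c hc => mul_nonneg (h0 b c) (sub_nonneg.2 (hm c hc))
  have hup : ∑ c, P a c * (v c - v m) ≤ (1 - P a m) * d := by
    rw [← Finset.add_sum_erase _ _ (Finset.mem_univ m), sub_self, mul_zero, zero_add]
    have : 1 - P a m = ∑ c ∈ Finset.univ.erase m, P a c := by
      rw [← h1 a, ← Finset.add_sum_erase _ _ (Finset.mem_univ m)]; ring
    rw [this, Finset.sum_mul]
    exact Finset.sum_le_sum fun c _ => mul_le_mul_of_nonneg_left (hv c m) (h0 a c)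
  rw [hshift a, hshift b]
  have := mul_le_mul_of_nonneg_right (hε a m) hd
  linarith

/-- Geometric ergodicity of an irreducible finite chain. -/
theorem exists_abs_transition_sub_le (hQ : IsGenerator Q) (hirr : IsIrreducible Q)
    {π : Fin K → ℝ} (hπ : IsStationary Q π) :
    ∃ C c : ℝ, 1 ≤ C ∧ 0 < c ∧ ∀ t : ℝ, 0 ≤ t → ∀ a i,
      |transition Q t a i - π i| ≤ C * Real.exp (-(c * t)) := by
  obtain ⟨T, hT, hpos⟩ := hirr.exists_transition_pos hQ
  obtain ⟨ε, hε0, hε1, hε⟩ : ∃ ε : ℝ, 0 < ε ∧ ε < 1 ∧ ∀ i j, ε ≤ transition Q T i j := by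
    rcases isEmpty_or_nonempty (Fin K) with h | h
    · exact ⟨1 / 2, by norm_num, by norm_num, fun i => h.elim i⟩
    · obtain ⟨m, hm⟩ := Finite.exists_min (fun p : Fin K × Fin K => transition Q T p.1 p.2)
      -- The cap at `1 / 2` keeps `1 - ε` positive, so that its logarithm can serve as a decay rate.
      refine ⟨min (transition Q T m.1 m.2) (1 / 2), lt_min (hpos _ _) (by norm_num),
        lt_of_le_of_lt (min_le_right _ _) (by norm_num), fun i j => ?_⟩
      exact (min_le_left _ _).trans (hm (i, j))
  have hosc : ∀ n : ℕ, ∀ s : ℝ, 0 ≤ s → ∀ i a b,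
      transition Q (n * T + s) a i - transition Q (n * T + s) b i ≤ (1 - ε) ^ n := by
    intro n
    induction n with
    | zero =>
      intro s hs i a b
      have h1 := transition_le_one hQ hs a i
      have h2 := transition_nonneg hQ hs b i
      simp only [Nat.cast_zero, zero_mul, zero_add, pow_zero]
      linarith
    | succ n ih =>
      intro s hs i a b
      have h := sum_mul_sub_sum_mul_le_of_stochastic hε (transition_nonneg hQ hT.le)
        (sum_transition hQ T) (ih s hs i) a b
      have he : ((n + 1 : ℕ) : ℝ) * T + s = T + (n * T + s) := by push_cast; ring
      rw [he, transition_add, Matrix.mul_apply, Matrix.mul_apply, pow_succ']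
      exact h
  set c : ℝ := -Real.log (1 - ε) / T with hc
  have hlog : Real.log (1 - ε) < 0 := Real.log_neg (by linarith) (by linarith)
  -- With this `c`, `(1 - ε)^(t/T) = e^{-ct}`; the prefactor pays for rounding `t / T` down to a
  -- whole number of blocks.
  refine ⟨(1 - ε)⁻¹, c, (one_le_inv₀ (by linarith)).2 (by linarith), div_pos (by linarith) hT,
    fun t ht a i => ?_⟩
  have hbound : ∀ a b, transition Q t a i - transition Q t b i ≤
      (1 - ε)⁻¹ * Real.exp (-(c * t)) := by
    intro a b
    set n := ⌊t / T⌋₊ with hn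
    have h1 : (n : ℝ) * T ≤ t := (le_div_iff₀ hT).1 (Nat.floor_le (by positivity))
    have h2 : t / T ≤ n + 1 := (Nat.lt_floor_add_one _).le
    have h := hosc n (t - n * T) (by linarith) i a b
    rw [add_sub_cancel] at h
    refine h.trans ?_
    have he : (1 - ε) ^ n = Real.exp (n * Real.log (1 - ε)) := by
      rw [Real.exp_nat_mul, Real.exp_log (by linarith)]
    have he' : (1 - ε)⁻¹ = Real.exp (-Real.log (1 - ε)) := by
      rw [Real.exp_neg, Real.exp_log (by linarith)]
    rw [he, he', ← Real.exp_add, Real.exp_le_exp]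
    have : -(c * t) = Real.log (1 - ε) * (t / T) := by rw [hc]; field_simp
    rw [this]
    nlinarith
  -- By stationarity `π i` is the `π`-average of `transition Q t b i` over `b`, so the oscillation
  -- in the starting state bounds the distance to `π i`.
  have hav : transition Q t a i - π i = ∑ b, π b * (transition Q t a i - transition Q t b i) := by
    simp_rw [mul_sub, Finset.sum_sub_distrib, ← Finset.sum_mul, hπ.sum_eq_one,
      hπ.sum_mul_transition, one_mul]
  rw [hav]
  refine (Finset.abs_sum_le_sum_abs _ _).trans ?_
  have hone : ∀ x : ℝ, x = ∑ b, π b * x := fun x => by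
    rw [← Finset.sum_mul, hπ.sum_eq_one, one_mul]
  rw [hone ((1 - ε)⁻¹ * _)]
  refine Finset.sum_le_sum fun b _ => ?_
  rw [abs_mul, abs_of_nonneg (hπ.nonneg b)]
  refine mul_le_mul_of_nonneg_left (abs_le.2 ⟨?_, hbound a b⟩) (hπ.nonneg b)
  linarith [hbound b a]

theorem exitRate_eq_neg_diag (hQ : IsGenerator Q) (i : Fin K) : exitRate Q i = -Q i i := by
  have h := hQ.row_sum i
  rw [← Finset.add_sum_erase _ _ (Finset.mem_univ i)] at h
  rw [exitRate]
  linarith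

theorem exitRate_pos (hQ : IsGenerator Q) (i : Fin K) : 0 < exitRate Q i := by
  rw [exitRate_eq_neg_diag hQ]
  linarith [hQ.diag_neg i]

end Transition

/-! ### Freshness observed on a grid -/

section Grid

variable {S : Type*} {x : ℝ≥0 → S}

/-- The freshness bit observed on the grid `0, δ, 2 δ, …`, for initially stale information. -/
def gridFresh (x : ℝ≥0 → S) (n : ℝ≥0 → ℕ) (δ : ℝ≥0) : ℕ → Prop
  | 0 => False
  | k + 1 => n (k * δ) < n ((k + 1 : ℕ) * δ) ∨
      (gridFresh x n δ k ∧ x ((k + 1 : ℕ) * δ) = x (k * δ))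

/-- The recursion is unrolled back to a sampled cell `l`. Agreement starts only at grid point `l +
1`: a sample overrides a change of state in its own cell. -/
theorem gridFresh_iff {n : ℝ≥0 → ℕ} {δ : ℝ≥0} {k : ℕ} :
    gridFresh x n δ k ↔ ∃ l < k, n (l * δ) < n ((l + 1 : ℕ) * δ) ∧
      ∀ j, l < j → j ≤ k → x (j * δ) = x (k * δ) := by
  induction k with
  | zero => simp [gridFresh]
  | succ k ih =>
    rw [gridFresh, ih]
    constructor
    · rintro (h | ⟨⟨l, hl, hn, hx⟩, hk⟩)
      · refine ⟨k, k.lt_succ_self, h, fun j h1 h2 => ?_⟩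
        rw [show j = k + 1 by omega]
      · refine ⟨l, by omega, hn, fun j h1 h2 => ?_⟩
        rcases Nat.lt_or_ge k j with h3 | h3
        · rw [show j = k + 1 by omega]
        · rw [hx j h1 h3, hk]
    · rintro ⟨l, hl, hn, hx⟩
      rcases Nat.lt_or_ge l k with h3 | h3
      · refine Or.inr ⟨⟨l, h3, hn, fun j h1 h2 => ?_⟩, (hx k h3 (by omega)).symm⟩
        rw [hx j h1 (by omega), hx k h3 (by omega)]
      · rw [show l = k by omega] at hn
        exact Or.inl hn

end Grid

/-! ### Right-continuous paths with discrete values -/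

section Paths

variable {S : Type*} [TopologicalSpace S] [DiscreteTopology S] {x : ℝ≥0 → S}

theorem exists_eqOn_of_continuousWithinAt_Ici {t : ℝ≥0} (h : ContinuousWithinAt x (Ici t) t) :
    ∃ ε > 0, ∀ u, t ≤ u → u < t + ε → x u = x t := by
  have h1 : x ⁻¹' {x t} ∈ 𝓝[≥] t := h ((isOpen_discrete {x t}).mem_nhds rfl)
  obtain ⟨u, hu, hsub⟩ := (mem_nhdsGE_iff_exists_Ico_subset' (lt_add_one t)).1 h1
  refine ⟨u - t, tsub_pos_of_lt hu, fun v h1 h2 => hsub ⟨h1, ?_⟩⟩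
  rwa [add_tsub_cancel_of_le (le_of_lt hu)] at h2

/-- Without jumps the path is continuous on an interval, which is connected, and its values are
discrete. -/
theorem eq_of_forall_not_jumpsAt (hx : ∀ t, ContinuousWithinAt x (Ici t) t) {s t : ℝ≥0}
    (h : ∀ u ∈ Ioc s t, ¬ JumpsAt x u) {u : ℝ≥0} (hu : u ∈ Icc s t) : x u = x s := by
  have hc : ContinuousOn x (Icc s t) := by
    intro v hv
    rcases eq_or_lt_of_le hv.1 with rfl | hlt
    · exact (hx s).mono Icc_subset_Ici_self
    · exact (not_not.1 (h v ⟨hlt, hv.2⟩)).continuousWithinAt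
  exact isPreconnected_Icc.constant hc hu ⟨le_rfl, hu.1.trans hu.2⟩

theorem not_jumpsAt_of_eqOn_Icc (hx : ∀ t, ContinuousWithinAt x (Ici t) t) {s u : ℝ≥0}
    (hsu : s < u) (h : ∀ v ∈ Icc s u, x v = x u) : ¬ JumpsAt x u := by
  rw [JumpsAt, not_not]
  obtain ⟨ε, hε, hright⟩ := exists_eqOn_of_continuousWithinAt_Ici (hx u)
  have hev : ∀ᶠ v in 𝓝 u, x v = x u := by
    filter_upwards [Ioo_mem_nhds hsu (lt_add_of_pos_right u hε)] with v hv
    rcases le_total v u with hvu | hvu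
    · exact h v ⟨hv.1.le, hvu⟩
    · exact hright v hvu hv.2
  exact ContinuousAt.congr continuousAt_const (hev.mono fun v hv => hv.symm)

theorem forall_not_jumpsAt_iff (hx : ∀ t, ContinuousWithinAt x (Ici t) t) {s t : ℝ≥0} :
    (∀ u ∈ Ioc s t, ¬ JumpsAt x u) ↔ ∀ u ∈ Icc s t, x u = x s := by
  refine ⟨fun h u hu => eq_of_forall_not_jumpsAt hx h hu, fun h u hu => ?_⟩
  refine not_jumpsAt_of_eqOn_Icc hx hu.1 fun v hv => ?_
  rw [h v ⟨hv.1, hv.2.trans hu.2⟩, h u ⟨hu.1.le, hu.2⟩]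

end Paths

/-! ### Comparison of grid freshness with true freshness -/

variable {K : ℕ} {x : ℝ≥0 → Fin K} {n : ℝ≥0 → ℕ}

/-- The state is constant from the sample at `s` until slightly after `t`, so all grid points in
between see one state, whatever the mesh. -/
theorem exists_gridFresh_of_isFresh (hx : ∀ t, ContinuousWithinAt x (Ici t) t) (hn : Monotone n)
    (hnr : ∀ t, ContinuousWithinAt n (Ici t) t) {t : ℝ≥0} (h : IsFresh x n false t) :
    ∃ ε > 0, ∀ δ > 0, ∀ k : ℕ, t ≤ k * δ → k * δ < t + ε → gridFresh x n δ k := by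
  rcases h with ⟨s, hst, hjump, hnoj⟩ | ⟨h, -⟩
  swap
  · exact absurd h (by simp)
  rw [forall_not_jumpsAt_iff hx] at hnoj
  obtain ⟨ε, hε, hright⟩ := exists_eqOn_of_continuousWithinAt_Ici (hx t)
  -- At the least point of `ℝ≥0`, right-continuity is continuity, so no sample occurs at time `0`.
  have hs0 : 0 < s := by
    refine pos_iff_ne_zero.2 fun h0 => hjump ?_
    subst h0
    have := hnr 0
    rwa [← NNReal.bot_eq_zero, Ici_bot, continuousWithinAt_univ] at this
  refine ⟨ε, hε, fun δ hδ k htk hkt => gridFresh_iff.2 ?_⟩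
  have hxc : ∀ u, s ≤ u → u < t + ε → x u = x s := by
    intro u h1 h2
    rcases le_total u t with h3 | h3
    · exact hnoj u ⟨h1, h3⟩
    · rw [hright u h3 h2, hnoj t ⟨hst, le_rfl⟩]
  -- This is the cell `(l δ, (l + 1) δ]` that contains `s`.
  obtain ⟨l, hl⟩ : ∃ l, ⌈s / δ⌉₊ = l + 1 :=
    Nat.exists_eq_add_one.2 (Nat.ceil_pos.2 (by positivity))
  have hsl : s ≤ (l + 1 : ℕ) * δ := by
    rw [← div_le_iff₀ hδ, ← hl]
    exact Nat.le_ceil _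
  have hls : l * δ < s := by
    rw [← lt_div_iff₀ hδ]
    exact Nat.lt_ceil.1 (by omega)
  have hlk : l < k := by
    have h1 : (l : ℝ≥0) * δ < k * δ := hls.trans_le (hst.trans htk)
    exact_mod_cast lt_of_mul_lt_mul_right h1 zero_le
  refine ⟨l, hlk, ?_, fun j h1 h2 => ?_⟩
  · by_contra hle
    have heq : ∀ v, l * δ ≤ v → v ≤ (l + 1 : ℕ) * δ → n v = n (l * δ) := fun v h1 h2 =>
      le_antisymm ((hn h2).trans (not_lt.1 hle)) (hn h1)
    refine not_jumpsAt_of_eqOn_Icc hnr hls (fun v hv => ?_) hjump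
    rw [heq v hv.1 (hv.2.trans hsl), heq s hls.le hsl]
  · have hj : (l + 1 : ℕ) * δ ≤ j * δ := by gcongr; exact h1
    have hjk : j * δ ≤ k * δ := by gcongr
    rw [hxc _ (hsl.trans hj) (hjk.trans_lt hkt), hxc _ (hst.trans htk) hkt]

/-- The danger is a change of state that the grid misses. The state at the last sample and some
different later state each persist for a while by right-continuity; a finer mesh hits both. -/
theorem exists_not_gridFresh_of_not_isFresh (hx : ∀ t, ContinuousWithinAt x (Ici t) t)
    (hn : Monotone n) (hnr : ∀ t, ContinuousWithinAt n (Ici t) t) {t : ℝ≥0}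
    (h : ¬ IsFresh x n false t) :
    ∃ ε > 0, ∀ δ > 0, δ < ε → ∀ k : ℕ, t ≤ k * δ → k * δ < t + ε → ¬ gridFresh x n δ k := by
  obtain ⟨ε, hε, hright⟩ := exists_eqOn_of_continuousWithinAt_Ici (hnr t)
  have hle : ∀ u, u < t + ε → n u ≤ n t := by
    intro u hu
    rcases le_total u t with h3 | h3
    · exact hn h3
    · exact (hright u h3 hu).le
  -- Its infimum is when the counter first reaches its level at `t`: the last sample time, or `0` if
  -- there was no sample.
  set A : Set ℝ≥0 := {r | n t ≤ n r} with hA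
  set s := sInf A with hs
  have htA : t ∈ A := le_refl (n t)
  have hst : s ≤ t := csInf_le' htA
  have hsA : n t ≤ n s := by
    obtain ⟨η, hη, hr⟩ := exists_eqOn_of_continuousWithinAt_Ici (hnr s)
    obtain ⟨r, hrA, hrs⟩ := exists_lt_of_csInf_lt ⟨t, htA⟩ (lt_add_of_pos_right s hη)
    rw [← hr r (csInf_le' hrA) hrs]
    exact hrA
  have hlast : ∀ r, r < s → n r < n s := fun r hr =>
    lt_of_lt_of_le (not_le.1 fun h => notMem_of_lt_csInf' hr h) hsA
  by_cases hs0 : s = 0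
  · refine ⟨ε, hε, fun δ hδ _ k _ hkt hg => ?_⟩
    obtain ⟨l, hlk, hlt, -⟩ := gridFresh_iff.1 hg
    have h1 : n s ≤ n (l * δ) := hn (by rw [hs0]; exact zero_le)
    have h2 : ((l + 1 : ℕ) : ℝ≥0) * δ ≤ k * δ := by gcongr; exact hlk
    have h3 := hle _ (h2.trans_lt hkt)
    omega
  have hjump : JumpsAt n s := by
    intro hc
    have hev : ∀ᶠ v in 𝓝 s, n v = n s :=
      hc ((isOpen_discrete {n s}).mem_nhds rfl)
    obtain ⟨r, hr, hmem⟩ := exists_Ioc_subset_of_mem_nhds hev ⟨0, pos_iff_ne_zero.2 hs0⟩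
    obtain ⟨v, hv1, hv2⟩ := exists_between hr
    exact (hlast v hv2).ne (hmem ⟨hv1, hv2.le⟩)
  obtain ⟨u, hu, hne⟩ : ∃ u ∈ Icc s t, x u ≠ x s := by
    by_contra! hcon
    exact h (Or.inl ⟨s, hst, hjump, (forall_not_jumpsAt_iff hx).2 hcon⟩)
  obtain ⟨ε₁, hε₁, hr₁⟩ := exists_eqOn_of_continuousWithinAt_Ici (hx s)
  obtain ⟨ε₂, hε₂, hr₂⟩ := exists_eqOn_of_continuousWithinAt_Ici (hx u)
  refine ⟨min ε (min ε₁ ε₂), lt_min hε (lt_min hε₁ hε₂), fun δ hδ hlt k htk hkt hg => ?_⟩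
  simp only [lt_min_iff] at hlt
  replace hkt : k * δ < t + ε := hkt.trans_le (by gcongr; exact min_le_left _ _)
  obtain ⟨l, hlk, hjl, hconst⟩ := gridFresh_iff.1 hg
  have h2 : ((l + 1 : ℕ) : ℝ≥0) * δ ≤ k * δ := by gcongr; exact hlk
  have h3 := hle _ (h2.trans_lt hkt)
  have hls : l * δ < s := by
    by_contra hcon
    have := hn (not_lt.1 hcon)
    omega
  have hceil : ∀ r : ℝ≥0, s ≤ r → r ≤ t →
      ∃ a : ℕ, l < a ∧ a ≤ k ∧ r ≤ a * δ ∧ a * δ < r + δ := by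
    intro r hsr hrt
    refine ⟨⌈r / δ⌉₊, Nat.lt_ceil.2 ?_, Nat.ceil_le.2 ?_, ?_, ?_⟩
    · rw [lt_div_iff₀ hδ]; exact hls.trans_le hsr
    · rw [div_le_iff₀ hδ]; exact hrt.trans htk
    · rw [← div_le_iff₀ hδ]; exact Nat.le_ceil _
    · have := Nat.ceil_lt_add_one (zero_le : 0 ≤ r / δ)
      calc (⌈r / δ⌉₊ : ℝ≥0) * δ < (r / δ + 1) * δ := by gcongr
        _ = r + δ := by rw [add_mul, div_mul_cancel₀ _ hδ.ne', one_mul]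
  obtain ⟨a, ha1, ha2, ha3, ha4⟩ := hceil s le_rfl hst
  obtain ⟨c, hc1, hc2, hc3, hc4⟩ := hceil u hu.1 hu.2
  have e1 := hr₁ _ ha3 (ha4.trans (by gcongr; exact hlt.2.1))
  have e2 := hr₂ _ hc3 (hc4.trans (by gcongr; exact hlt.2.2))
  apply hne
  rw [← e1, ← e2, hconst a ha1 ha2, hconst c hc1 hc2]

theorem eventually_natCast_inv_lt {ε : ℝ≥0} (hε : 0 < ε) :
    ∀ᶠ m : ℕ in atTop, 0 < (m : ℝ≥0) ∧ (m : ℝ≥0)⁻¹ < ε := by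
  have h : Tendsto (fun m : ℕ => (m : ℝ≥0)⁻¹) atTop (𝓝 0) :=
    tendsto_inv_atTop_zero.comp tendsto_natCast_atTop_atTop
  filter_upwards [h.eventually_lt_const hε, eventually_gt_atTop 0] with m h1 h2
  exact ⟨Nat.cast_pos.2 h2, h1⟩

/-- Along grids of vanishing mesh, the grid freshness converges to the freshness process. -/
theorem eventually_gridFresh_iff (hx : ∀ t, ContinuousWithinAt x (Ici t) t) (hn : Monotone n)
    (hnr : ∀ t, ContinuousWithinAt n (Ici t) t) (t : ℝ≥0) :
    ∀ᶠ m : ℕ in atTop, (gridFresh x n (m : ℝ≥0)⁻¹ ⌈t * m⌉₊ ↔ IsFresh x n false t) := by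
  obtain ⟨ε, hε, h⟩ : ∃ ε > 0, ∀ δ > 0, δ < ε → ∀ k : ℕ, t ≤ k * δ → k * δ < t + ε →
      (gridFresh x n δ k ↔ IsFresh x n false t) := by
    by_cases hf : IsFresh x n false t
    · obtain ⟨ε, hε, h⟩ := exists_gridFresh_of_isFresh hx hn hnr hf
      exact ⟨ε, hε, fun δ hδ _ k h1 h2 => iff_of_true (h δ hδ k h1 h2) hf⟩
    · obtain ⟨ε, hε, h⟩ := exists_not_gridFresh_of_not_isFresh hx hn hnr hf
      exact ⟨ε, hε, fun δ hδ hlt k h1 h2 => iff_of_false (h δ hδ hlt k h1 h2) hf⟩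
  filter_upwards [eventually_natCast_inv_lt hε] with m hm
  obtain ⟨hpos, hlt⟩ := hm
  have h1 : t ≤ (⌈t * m⌉₊ : ℝ≥0) * (m : ℝ≥0)⁻¹ := by
    rw [← div_eq_mul_inv, le_div_iff₀ hpos]
    exact Nat.le_ceil _
  have h2 : (⌈t * m⌉₊ : ℝ≥0) * (m : ℝ≥0)⁻¹ < t + ε := by
    have h3 : t + (m : ℝ≥0)⁻¹ < t + ε := by gcongr
    refine lt_of_lt_of_le ?_ h3.le
    rw [← div_eq_mul_inv, div_lt_iff₀ hpos, add_mul, inv_mul_cancel₀ hpos.ne']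
    exact Nat.ceil_lt_add_one zero_le
  exact h _ (inv_pos.2 hpos) hlt _ h1 h2

/-! ### The filtration of grid histories -/

section GridHistory

variable {K : ℕ} {Ω : Type*} {X : ℝ≥0 → Ω → Fin K} {N : ℝ≥0 → Ω → ℕ}

/-- The states at the grid points `0, δ, …, k δ`, and the cells among the first `k` that contain
a sample. -/
def gridHistory (X : ℝ≥0 → Ω → Fin K) (N : ℝ≥0 → Ω → ℕ) (δ : ℝ≥0) (k : ℕ) (ω : Ω) :
    (Fin (k + 1) → Fin K) × (Fin k → Bool) :=
  (fun j => X ((j : ℕ) * δ) ω,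
    fun j => decide (N ((j : ℕ) * δ) ω < N (((j : ℕ) + 1 : ℕ) * δ) ω))

/-- The σ-algebra generated by the grid history. -/
@[reducible]
def gridFiltration (X : ℝ≥0 → Ω → Fin K) (N : ℝ≥0 → Ω → ℕ) (δ : ℝ≥0) (k : ℕ) :
    MeasurableSpace Ω :=
  MeasurableSpace.comap (gridHistory X N δ k) ⊤

theorem measurableSet_gridFiltration_cell (δ : ℝ≥0) {j k : ℕ} (hjk : j < k) :
    MeasurableSet[gridFiltration X N δ k] {ω | N (j * δ) ω < N ((j + 1 : ℕ) * δ) ω} :=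
  ⟨{p | p.2 ⟨j, hjk⟩ = true}, trivial, by ext ω; simp [gridHistory]⟩

theorem gridFiltration_mono (X : ℝ≥0 → Ω → Fin K) (N : ℝ≥0 → Ω → ℕ) (δ : ℝ≥0) :
    Monotone (gridFiltration X N δ) := by
  refine monotone_nat_of_le_succ fun k => ?_
  rintro _ ⟨S, -, rfl⟩
  exact ⟨(fun p => (fun j => p.1 j.castSucc, fun j => p.2 j.castSucc)) ⁻¹' S, trivial, rfl⟩

theorem measurableSet_gridFiltration_gridFresh (δ : ℝ≥0) (k : ℕ) :
    MeasurableSet[gridFiltration X N δ k] {ω | gridFresh (X · ω) (N · ω) δ k} := by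
  induction k with
  | zero =>
    simp only [gridFresh]
    exact @MeasurableSet.empty _ (gridFiltration X N δ 0)
  | succ k ih =>
    have hst : MeasurableSet[gridFiltration X N δ (k + 1)]
        {ω | X ((k + 1 : ℕ) * δ) ω = X (k * δ) ω} :=
      ⟨{p | p.1 ⟨k + 1, by omega⟩ = p.1 ⟨k, by omega⟩}, trivial, rfl⟩
    exact (measurableSet_gridFiltration_cell δ k.lt_succ_self).union
      ((gridFiltration_mono X N δ k.le_succ _ ih).inter hst)

end GridHistory

/-! ### The joint law of source and sampler on the grid -/

section GridLaw

variable {K : ℕ} {Ω : Type*} [MeasurableSpace Ω] {Q : Matrix (Fin K) (Fin K) ℝ} {lam : ℝ≥0}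
  {X : ℝ≥0 → Ω → Fin K} {N : ℝ≥0 → Ω → ℕ} {μ : Measure Ω}

/-- Probability that a grid cell of length `δ` contains a sample (`true`) or not (`false`). -/
noncomputable def cellProb (lam δ : ℝ≥0) (b : Bool) : ℝ :=
  if b then 1 - Real.exp (-(lam * δ)) else Real.exp (-(lam * δ))

theorem IsCTMC.measureReal_grid_succ (h : IsCTMC Q X μ) (δ : ℝ≥0) (k : ℕ) (y : ℕ → Fin K) :
    μ.real {ω | ∀ j ≤ k + 1, X (j * δ) ω = y j} =
      μ.real {ω | ∀ j ≤ k, X (j * δ) ω = y j} * transition Q δ (y k) (y (k + 1)) := by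
  have key : ∀ n : ℕ, μ.real {ω | ∀ j ≤ n, X (j * δ) ω = y j} =
      μ.real {ω | X ((0 : ℕ) * δ) ω = y 0} *
        ∏ j : Fin n, transition Q δ (y j) (y (j + 1)) := by
    intro n
    have hm : Monotone fun i : Fin (n + 1) => ((i : ℕ) : ℝ≥0) * δ := by
      intro a b hab
      have : (a : ℕ) ≤ b := hab
      dsimp only
      gcongr
    have := h.markov n (fun i => ((i : ℕ) : ℝ≥0) * δ) hm fun i => y i
    have hset : {ω | ∀ j ≤ n, X (j * δ) ω = y j} =
        {ω | ∀ i : Fin (n + 1), X ((i : ℕ) * δ) ω = y i} := by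
      ext ω
      exact ⟨fun h i => h i (Nat.lt_succ_iff.1 i.2), fun h j hj => h ⟨j, Nat.lt_succ_of_le hj⟩⟩
    rw [hset, this]
    congr 1
    refine Finset.prod_congr rfl fun j _ => ?_
    congr 1
    simp only [Fin.val_succ, Fin.val_castSucc]
    push_cast
    ring_nf
  rw [key, key, Fin.prod_univ_castSucc, mul_assoc]
  rfl

theorem IsPoissonProcess.measureReal_cell (h : IsPoissonProcess lam N μ) (δ : ℝ≥0) (k : ℕ)
    (b : Bool) :
    μ.real {ω | decide (N (k * δ) ω < N ((k + 1 : ℕ) * δ) ω) = b} = cellProb lam δ b := by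
  have hle : (k : ℝ≥0) * δ ≤ (k + 1 : ℕ) * δ := by gcongr; exact k.le_succ
  have hlaw := h.law _ _ hle
  have hlen : ((k + 1 : ℕ) : ℝ≥0) * δ - k * δ = δ := by
    rw [← tsub_mul]; push_cast; rw [add_tsub_cancel_left, one_mul]
  rw [hlen] at hlaw
  have hmeas : Measurable fun ω => N ((k + 1 : ℕ) * δ) ω - N (k * δ) ω :=
    (h.measurable _).sub (h.measurable _)
  -- Independence of a trivial family of increments already forces total mass one.
  have hi := h.indepIncrements 0 (fun _ => 0) (fun _ _ _ => le_rfl)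
  have hP : IsProbabilityMeasure μ := hi.isProbabilityMeasure
  have h0 : μ.real {ω | ¬ N (k * δ) ω < N ((k + 1 : ℕ) * δ) ω} = Real.exp (-(lam * δ)) := by
    have := poissonMeasure_real_singleton (lam * δ) 0
    rw [← hlaw, map_measureReal_apply hmeas (measurableSet_singleton 0)] at this
    simp only [pow_zero, mul_one, Nat.factorial_zero, Nat.cast_one, div_one, NNReal.coe_mul] at this
    rw [← this]
    congr 1
    ext ω
    simp only [mem_ofPred_eq, mem_preimage, mem_singleton_iff]
    omega
  have hms : MeasurableSet {ω | N (k * δ) ω < N ((k + 1 : ℕ) * δ) ω} :=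
    measurableSet_lt (h.measurable _) (h.measurable _)
  cases b
  · simpa [cellProb] using h0
  · have := probReal_compl_eq_one_sub (μ := μ) hms
    rw [compl_ofPred, h0] at this
    simp only [cellProb, if_true, decide_eq_true_eq]
    linarith

theorem IsPoissonProcess.measureReal_grid_succ (h : IsPoissonProcess lam N μ) (δ : ℝ≥0) (k : ℕ)
    (β : ℕ → Bool) :
    μ.real {ω | ∀ j < k + 1, decide (N (j * δ) ω < N ((j + 1 : ℕ) * δ) ω) = β j} =
      μ.real {ω | ∀ j < k, decide (N (j * δ) ω < N ((j + 1 : ℕ) * δ) ω) = β j} *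
        cellProb lam δ (β k) := by
  have hm : Monotone fun j : ℕ => (j : ℝ≥0) * δ := fun a b hab => by dsimp only; gcongr
  have hi := h.indepIncrements.nat hm
  have key : ∀ n : ℕ, μ.real {ω | ∀ j < n, decide (N (j * δ) ω < N ((j + 1 : ℕ) * δ) ω) = β j} =
      ∏ j ∈ Finset.range n, cellProb lam δ (β j) := by
    intro n
    have := hi.measure_inter_preimage_eq_mul (Finset.range n)
      (sets := fun j => {d : ℕ | decide (0 < d) = β j}) fun j _ => MeasurableSet.of_discrete
    have hset : {ω | ∀ j < n, decide (N (j * δ) ω < N ((j + 1 : ℕ) * δ) ω) = β j} =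
        ⋂ j ∈ Finset.range n, (fun ω => N ((j + 1 : ℕ) * δ) ω - N (j * δ) ω) ⁻¹'
          {d : ℕ | decide (0 < d) = β j} := by
      ext ω
      simp [tsub_pos_iff_lt]
    rw [hset, measureReal_def, this, ENNReal.toReal_prod]
    refine Finset.prod_congr rfl fun j _ => ?_
    rw [← h.measureReal_cell δ j (β j), measureReal_def]
    congr 2
    ext ω
    simp [tsub_pos_iff_lt]
  rw [key, key, Finset.prod_range_succ]

theorem IsPoissonSampled.measurable_gridHistory (h : IsPoissonSampled Q lam X N μ) (δ : ℝ≥0)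
    (k : ℕ) : Measurable (gridHistory X N δ k) := by
  refine Measurable.prodMk (measurable_pi_lambda _ fun j => h.source.measurable _)
    (measurable_pi_lambda _ fun j => ?_)
  refine measurable_to_bool ?_
  have : MeasurableSet {ω | N ((j : ℕ) * δ) ω < N (((j : ℕ) + 1 : ℕ) * δ) ω} :=
    measurableSet_lt (h.sampler.measurable _) (h.sampler.measurable _)
  simpa [preimage] using this

theorem IsPoissonSampled.gridFiltration_le (h : IsPoissonSampled Q lam X N μ) (δ : ℝ≥0)
    (k : ℕ) {E : Set Ω} (hE : MeasurableSet[gridFiltration X N δ k] E) : MeasurableSet E := by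
  obtain ⟨S, -, rfl⟩ := hE
  exact h.measurable_gridHistory δ k MeasurableSet.of_discrete

theorem IsPoissonSampled.measureReal_inter (h : IsPoissonSampled Q lam X N μ) (δ : ℝ≥0)
    (k l : ℕ) (y : ℕ → Fin K) (β : ℕ → Bool) :
    μ.real ({ω | ∀ j ≤ k, X (j * δ) ω = y j} ∩
        {ω | ∀ j < l, decide (N (j * δ) ω < N ((j + 1 : ℕ) * δ) ω) = β j}) =
      μ.real {ω | ∀ j ≤ k, X (j * δ) ω = y j} *
        μ.real {ω | ∀ j < l, decide (N (j * δ) ω < N ((j + 1 : ℕ) * δ) ω) = β j} := by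
  have h1 : MeasurableSet {x : ℝ≥0 → Fin K | ∀ j ≤ k, x ((j : ℕ) * δ) = y j} := by
    simp only [ofPred_forall]
    refine MeasurableSet.iInter fun j => MeasurableSet.iInter fun _ => ?_
    have hm : Measurable fun x : ℝ≥0 → Fin K => x ((j : ℕ) * δ) := measurable_pi_apply _
    exact hm (measurableSet_singleton (y j))
  have h2 : MeasurableSet {n : ℝ≥0 → ℕ | ∀ j < l,
      decide (n ((j : ℕ) * δ) < n ((j + 1 : ℕ) * δ)) = β j} := by
    simp only [ofPred_forall]
    refine MeasurableSet.iInter fun j => MeasurableSet.iInter fun _ => ?_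
    have hm : Measurable fun n : ℝ≥0 → ℕ => (n ((j : ℕ) * δ), n ((j + 1 : ℕ) * δ)) :=
      (measurable_pi_apply _).prodMk (measurable_pi_apply _)
    exact hm (MeasurableSet.of_discrete (s := {p : ℕ × ℕ | decide (p.1 < p.2) = β j}))
  have := h.indep.measure_inter_preimage_eq_mul _ _ h1 h2
  rw [measureReal_def, measureReal_def, measureReal_def, ← ENNReal.toReal_mul]
  exact congrArg ENNReal.toReal this

theorem IsPoissonSampled.measureReal_history_step [IsProbabilityMeasure μ]
    (h : IsPoissonSampled Q lam X N μ) (δ : ℝ≥0)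
    (k : ℕ) (p : (Fin (k + 1) → Fin K) × (Fin k → Bool)) (i : Fin K) (b : Bool) :
    μ.real (gridHistory X N δ k ⁻¹' {p} ∩ {ω | X ((k + 1 : ℕ) * δ) ω = i ∧
        decide (N (k * δ) ω < N ((k + 1 : ℕ) * δ) ω) = b}) =
      μ.real (gridHistory X N δ k ⁻¹' {p}) *
        (transition Q δ (p.1 (Fin.last k)) i * cellProb lam δ b) := by
  -- The prescribed history is extended by the new state and the new cell, so both events become
  -- rectangles, one factor for the source and one for the sampler.
  set y : ℕ → Fin K := fun j => if hj : j < k + 1 then p.1 ⟨j, hj⟩ else i with hy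
  set β : ℕ → Bool := fun j => if hj : j < k then p.2 ⟨j, hj⟩ else b with hβ
  have hyk : ∀ j (hj : j < k + 1), y j = p.1 ⟨j, hj⟩ := fun j hj => dif_pos hj
  have hyk1 : y (k + 1) = i := dif_neg (lt_irrefl _)
  have hβk : ∀ j (hj : j < k), β j = p.2 ⟨j, hj⟩ := fun j hj => dif_pos hj
  have hβk1 : β k = b := dif_neg (lt_irrefl _)
  have hp : gridHistory X N δ k ⁻¹' {p} = {ω | ∀ j ≤ k, X (j * δ) ω = y j} ∩
      {ω | ∀ j < k, decide (N (j * δ) ω < N ((j + 1 : ℕ) * δ) ω) = β j} := by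
    ext ω
    simp only [mem_preimage, mem_singleton_iff, gridHistory, Prod.ext_iff, funext_iff, mem_inter_iff,
      mem_ofPred_eq]
    refine and_congr ⟨fun hf j hj => ?_, fun hf j => ?_⟩ ⟨fun hf j hj => ?_, fun hf j => ?_⟩
    · rw [hyk j (Nat.lt_succ_of_le hj)]; exact hf ⟨j, _⟩
    · rw [← hyk j j.2]; exact hf j (Nat.lt_succ_iff.1 j.2)
    · rw [hβk j hj]; exact hf ⟨j, _⟩
    · rw [← hβk j j.2]; exact hf j j.2
  have hp' : gridHistory X N δ k ⁻¹' {p} ∩ {ω | X ((k + 1 : ℕ) * δ) ω = i ∧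
        decide (N (k * δ) ω < N ((k + 1 : ℕ) * δ) ω) = b} =
      {ω | ∀ j ≤ k + 1, X (j * δ) ω = y j} ∩
      {ω | ∀ j < k + 1, decide (N (j * δ) ω < N ((j + 1 : ℕ) * δ) ω) = β j} := by
    rw [hp]
    ext ω
    simp only [mem_inter_iff, mem_ofPred_eq]
    constructor
    · rintro ⟨⟨h1, h2⟩, h3, h4⟩
      refine ⟨fun j hj => ?_, fun j hj => ?_⟩
      · rcases Nat.lt_or_ge k j with hkj | hkj
        · rw [show j = k + 1 by omega, hyk1]; exact h3
        · exact h1 j hkj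
      · rcases Nat.lt_or_ge j k with hkj | hkj
        · exact h2 j hkj
        · rw [show j = k by omega, hβk1]; exact h4
    · rintro ⟨h1, h2⟩
      refine ⟨⟨fun j hj => h1 j (by omega), fun j hj => h2 j (by omega)⟩, ?_, ?_⟩
      · rw [← hyk1]; exact h1 _ le_rfl
      · rw [← hβk1]; exact h2 _ k.lt_succ_self
  rw [hp', h.measureReal_inter, h.source.measureReal_grid_succ, h.sampler.measureReal_grid_succ,
    hp, h.measureReal_inter, hyk1, hβk1, hyk k k.lt_succ_self]
  have : (⟨k, k.lt_succ_self⟩ : Fin (k + 1)) = Fin.last k := rfl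
  rw [this]
  ring

/-- The Markov property on the grid, jointly for the source and the sampler. -/
theorem IsPoissonSampled.measureReal_step [IsProbabilityMeasure μ]
    (h : IsPoissonSampled Q lam X N μ) (δ : ℝ≥0)
    {k : ℕ} {E : Set Ω} (hE : MeasurableSet[gridFiltration X N δ k] E) (a i : Fin K) (b : Bool) :
    μ.real ((E ∩ {ω | X (k * δ) ω = a}) ∩ {ω | X ((k + 1 : ℕ) * δ) ω = i ∧
        decide (N (k * δ) ω < N ((k + 1 : ℕ) * δ) ω) = b}) =
      μ.real (E ∩ {ω | X (k * δ) ω = a}) * (transition Q δ a i * cellProb lam δ b) := by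
  classical
  obtain ⟨S, -, rfl⟩ := hE
  -- The event is a finite disjoint union of atoms of the history, all ending in `a`, hence all with
  -- the same one-step factor.
  set T : Finset ((Fin (k + 1) → Fin K) × (Fin k → Bool)) :=
    Finset.univ.filter fun p => p ∈ S ∧ p.1 (Fin.last k) = a with hT
  have hset : gridHistory X N δ k ⁻¹' S ∩ {ω | X (k * δ) ω = a} = gridHistory X N δ k ⁻¹' T := by
    ext ω
    simp [hT, gridHistory]
  have hB := h.gridFiltration_le δ (k + 1) (E := {ω | X ((k + 1 : ℕ) * δ) ω = i ∧
        decide (N (k * δ) ω < N ((k + 1 : ℕ) * δ) ω) = b})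
      ⟨{p | p.1 ⟨k + 1, by omega⟩ = i ∧ p.2 ⟨k, by omega⟩ = b}, trivial, rfl⟩
  have hm : ∀ p ∈ T, MeasurableSet (gridHistory X N δ k ⁻¹' {p}) := fun p _ =>
    h.measurable_gridHistory δ k (measurableSet_singleton p)
  rw [hset, ← measureReal_restrict_apply' hB, ← sum_measureReal_preimage_singleton T hm,
    ← sum_measureReal_preimage_singleton T hm, Finset.sum_mul]
  refine Finset.sum_congr rfl fun p hp => ?_
  rw [measureReal_restrict_apply' hB, h.measureReal_history_step, (Finset.mem_filter.1 hp).2.2]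

end GridLaw

/-- Stability of the recursion `e (l + 1) ≤ (1 - q) w + q e l` with exponentially small input. -/
theorem le_two_mul_exp_of_recursion {C c lam δ : ℝ} (hC : 1 ≤ C) (hδ : 0 ≤ δ)
    (hc : c ≤ lam / 2) {e : ℕ → ℝ} (h0 : e 0 ≤ 1)
    (hrec : ∀ l : ℕ, e (l + 1) ≤ (1 - Real.exp (-(lam * δ))) * (C * Real.exp (-(c * ((l + 1 : ℕ) * δ))))
      + Real.exp (-(lam * δ)) * e l) (l : ℕ) :
    e l ≤ 2 * C * Real.exp (-(c * (l * δ))) := by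
  induction l with
  | zero => simp; linarith
  | succ l ih =>
    refine (hrec l).trans ?_
    set q := Real.exp (-(lam * δ)) with hq
    set E := Real.exp (-(c * ((l + 1 : ℕ) * δ))) with hE
    -- Half of the decay `q = r²` absorbs the slower rate `c ≤ lam / 2`. The induction then closes
    -- because `(1 - r²) + 2 r ≤ 2`, that is, `(1 - r)² ≥ 0`.
    set r := Real.exp (-(lam / 2 * δ)) with hr
    have hqr : q = r * r := by rw [hq, hr, ← Real.exp_add]; congr 1; ring
    have hqe : q * Real.exp (-(c * (l * δ))) ≤ r * E := by
      rw [hq, hr, hE, ← Real.exp_add, ← Real.exp_add, Real.exp_le_exp]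
      push_cast
      nlinarith
    have h1 : q * e l ≤ 2 * C * (r * E) := by
      calc q * e l ≤ q * (2 * C * Real.exp (-(c * (l * δ)))) :=
            mul_le_mul_of_nonneg_left ih (Real.exp_nonneg _)
        _ = 2 * C * (q * Real.exp (-(c * (l * δ)))) := by ring
        _ ≤ 2 * C * (r * E) := by gcongr
    have hE0 : 0 ≤ C * E := mul_nonneg (by linarith) (Real.exp_nonneg _)
    have h2 : 0 ≤ C * E * (1 - r) ^ 2 := mul_nonneg hE0 (sq_nonneg _)
    rw [hqr] at h1 ⊢
    nlinarith

/-! ### Exponential mixing of the grid freshness -/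

section Mixing

variable {K : ℕ} {Ω : Type*} [MeasurableSpace Ω] {Q : Matrix (Fin K) (Fin K) ℝ} {lam : ℝ≥0}
  {X : ℝ≥0 → Ω → Fin K} {N : ℝ≥0 → Ω → ℕ} {μ : Measure Ω}

theorem cellProb_nonneg (lam δ : ℝ≥0) (b : Bool) : 0 ≤ cellProb lam δ b := by
  cases b
  · simpa [cellProb] using Real.exp_nonneg _
  · simp only [cellProb, if_true, sub_nonneg, Real.exp_le_one_iff, Left.neg_nonpos_iff]
    positivity

theorem cellProb_true (lam δ : ℝ≥0) : cellProb lam δ true = 1 - cellProb lam δ false := by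
  simp [cellProb]

theorem measureReal_eq_sum_inter [IsProbabilityMeasure μ] {Y : Ω → Fin K} (hY : Measurable Y)
    (E : Set Ω) : μ.real E = ∑ a, μ.real (E ∩ {ω | Y ω = a}) := by
  have h := sum_measureReal_preimage_singleton (μ := μ.restrict E) Finset.univ
    (fun a _ => hY (measurableSet_singleton a))
  rw [Finset.coe_univ, preimage_univ, measureReal_restrict_apply MeasurableSet.univ,
    univ_inter] at h
  rw [← h]
  refine Finset.sum_congr rfl fun a _ => ?_
  rw [measureReal_restrict_apply (hY (measurableSet_singleton a)), inter_comm]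
  rfl

theorem IsPoissonSampled.measurableSet_cell (h : IsPoissonSampled Q lam X N μ) (δ : ℝ≥0) (k : ℕ) :
    MeasurableSet {ω | N (k * δ) ω < N ((k + 1 : ℕ) * δ) ω} :=
  measurableSet_lt (h.sampler.measurable _) (h.sampler.measurable _)

variable [IsProbabilityMeasure μ]

theorem IsPoissonSampled.measureReal_cell_step (h : IsPoissonSampled Q lam X N μ) (δ : ℝ≥0)
    {k : ℕ} {E : Set Ω} (hE : MeasurableSet[gridFiltration X N δ k] E) (i : Fin K) (b : Bool) :
    μ.real (E ∩ {ω | X ((k + 1 : ℕ) * δ) ω = i ∧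
        decide (N (k * δ) ω < N ((k + 1 : ℕ) * δ) ω) = b}) =
      cellProb lam δ b * ∑ a, μ.real (E ∩ {ω | X (k * δ) ω = a}) * transition Q δ a i := by
  rw [measureReal_eq_sum_inter (h.source.measurable (k * δ)), Finset.mul_sum]
  refine Finset.sum_congr rfl fun a _ => ?_
  rw [inter_right_comm, h.measureReal_step δ hE]
  ring

theorem measureReal_inter_decide_add {P : Ω → Prop} [DecidablePred P]
    (hP : MeasurableSet {ω | P ω}) (E : Set Ω) (R : Ω → Prop) :
    μ.real (E ∩ {ω | R ω}) = μ.real (E ∩ {ω | R ω ∧ decide (P ω) = true}) +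
      μ.real (E ∩ {ω | R ω ∧ decide (P ω) = false}) := by
  rw [← measureReal_inter_add_sdiff (s := E ∩ {ω | R ω}) hP]
  congr 2 <;>
  · ext ω
    simp [and_assoc]

theorem IsPoissonSampled.measureReal_state_step (h : IsPoissonSampled Q lam X N μ) (δ : ℝ≥0)
    {k : ℕ} {E : Set Ω} (hE : MeasurableSet[gridFiltration X N δ k] E) (i : Fin K) :
    μ.real (E ∩ {ω | X ((k + 1 : ℕ) * δ) ω = i}) =
      ∑ a, μ.real (E ∩ {ω | X (k * δ) ω = a}) * transition Q δ a i := by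
  rw [measureReal_inter_decide_add (h.measurableSet_cell δ k), h.measureReal_cell_step δ hE,
    h.measureReal_cell_step δ hE, cellProb_true]
  ring

theorem IsPoissonSampled.measureReal_state_add (h : IsPoissonSampled Q lam X N μ) (δ : ℝ≥0)
    {j : ℕ} {E : Set Ω} (hE : MeasurableSet[gridFiltration X N δ j] E) (l : ℕ) (i : Fin K) :
    μ.real (E ∩ {ω | X ((j + l : ℕ) * δ) ω = i}) =
      ∑ a, μ.real (E ∩ {ω | X (j * δ) ω = a}) * transition Q (l * δ) a i := by
  induction l generalizing i with
  | zero => simp [Matrix.one_apply]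
  | succ l ih =>
    have hE' := gridFiltration_mono X N δ (Nat.le_add_right j l) _ hE
    rw [← add_assoc, h.measureReal_state_step δ hE']
    simp_rw [ih, Finset.sum_mul]
    rw [Finset.sum_comm]
    refine Finset.sum_congr rfl fun a _ => ?_
    have : ((l + 1 : ℕ) : ℝ) * δ = l * δ + δ := by push_cast; ring
    rw [this, transition_add, Matrix.mul_apply, Finset.mul_sum]
    exact Finset.sum_congr rfl fun b _ => by ring

/-- Evolution of the joint law of freshness and state along the grid. -/
theorem IsPoissonSampled.measureReal_gridFresh_step (h : IsPoissonSampled Q lam X N μ) (δ : ℝ≥0)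
    {k : ℕ} {E : Set Ω} (hE : MeasurableSet[gridFiltration X N δ k] E) (i : Fin K) :
    μ.real (E ∩ {ω | gridFresh (X · ω) (N · ω) δ (k + 1)} ∩ {ω | X ((k + 1 : ℕ) * δ) ω = i}) =
      cellProb lam δ true * μ.real (E ∩ {ω | X ((k + 1 : ℕ) * δ) ω = i}) +
      cellProb lam δ false * (transition Q δ i i *
        μ.real (E ∩ {ω | gridFresh (X · ω) (N · ω) δ k} ∩ {ω | X (k * δ) ω = i})) := by
  -- If the cell contains a sample, the earlier bit is irrelevant; if not, the bit must already be
  -- set and the state must already be `i`.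
  rw [measureReal_inter_decide_add (h.measurableSet_cell δ k)]
  congr 1
  · rw [h.measureReal_state_step δ hE, ← h.measureReal_cell_step δ hE]
    congr 1
    ext ω
    simp only [mem_inter_iff, mem_ofPred_eq, decide_eq_true_eq, gridFresh]
    tauto
  · have hF := measurableSet_gridFiltration_gridFresh (X := X) (N := N) δ k
    have hcomm : ∀ x y z : ℝ, x * (y * z) = z * (y * x) := fun x y z => by ring
    rw [hcomm, ← h.measureReal_step δ (hE.inter hF) i i false]
    congr 1
    ext ω
    simp only [mem_inter_iff, mem_ofPred_eq, decide_eq_false_iff_not, gridFresh]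
    constructor
    · rintro ⟨⟨h1, h2⟩, h3, h4⟩
      rcases h2 with h2 | ⟨h2, h5⟩
      · exact absurd h2 h4
      · exact ⟨⟨⟨h1, h2⟩, h5 ▸ h3⟩, h3, h4⟩
    · rintro ⟨⟨⟨h1, h2⟩, h5⟩, h3, h4⟩
      exact ⟨⟨h1, Or.inr ⟨h2, h3.trans h5.symm⟩⟩, h3, h4⟩

/-- The stationary mean of the grid freshness. -/
noncomputable def gridMean (Q : Matrix (Fin K) (Fin K) ℝ) (π : Fin K → ℝ) (lam δ : ℝ≥0) : ℝ :=
  ∑ i, cellProb lam δ true * π i / (1 - cellProb lam δ false * transition Q δ i i)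

/-- For each state `i`, the mass `u` of `E`, freshness and state `i` satisfies an affine recursion
whose fixed point `s` is obtained by replacing the law of the state by `π`. The replacement error is
exponentially small by `hmix`, and `le_two_mul_exp_of_recursion` propagates it without dependence on
the mesh. -/
theorem IsPoissonSampled.abs_measureReal_gridFresh_sub_le (h : IsPoissonSampled Q lam X N μ)
    (hQ : IsGenerator Q) {π : Fin K → ℝ} (hπ : IsStationary Q π) (hlam : 0 < lam) {C c : ℝ}
    (hC : 1 ≤ C) (hc : c ≤ lam / 2)
    (hmix : ∀ t : ℝ, 0 ≤ t → ∀ a i, |transition Q t a i - π i| ≤ C * Real.exp (-(c * t)))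
    {δ : ℝ≥0} (hδ : 0 < δ) {j : ℕ} {E : Set Ω} (hE : MeasurableSet[gridFiltration X N δ j] E)
    (l : ℕ) :
    |μ.real (E ∩ {ω | gridFresh (X · ω) (N · ω) δ (j + l)}) - gridMean Q π lam δ * μ.real E| ≤
      K * (2 * C * Real.exp (-(c * (l * δ)))) := by
  set p := cellProb lam δ true with hp
  set q := cellProb lam δ false with hq
  have hpq : p = 1 - q := cellProb_true lam δ
  have hq0 : 0 ≤ q := cellProb_nonneg _ _ _
  have hp0 : 0 ≤ p := cellProb_nonneg _ _ _
  have hqe : q = Real.exp (-(lam * δ)) := by simp [hq, cellProb]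
  have hq1 : q < 1 := by
    rw [hqe, Real.exp_lt_one_iff, Left.neg_neg_iff]
    positivity
  set r : Fin K → ℝ := fun i => transition Q δ i i with hr
  have hr0 : ∀ i, 0 ≤ r i := fun i => transition_nonneg hQ δ.coe_nonneg i i
  have hr1 : ∀ i, r i ≤ 1 := fun i => transition_le_one hQ δ.coe_nonneg i i
  have hden : ∀ i, 0 < 1 - q * r i := fun i => by nlinarith [hr0 i, hr1 i]
  set s : Fin K → ℝ := fun i => p * π i / (1 - q * r i) * μ.real E with hs
  have hE1 : μ.real E ≤ 1 := measureReal_le_one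
  have hE0 : 0 ≤ μ.real E := measureReal_nonneg
  have hπ1 : ∀ i, π i ≤ 1 := fun i => by
    rw [← hπ.sum_eq_one]
    exact Finset.single_le_sum (fun k _ => hπ.nonneg k) (Finset.mem_univ i)
  have hs0 : ∀ i, 0 ≤ s i := fun i =>
    mul_nonneg (div_nonneg (mul_nonneg hp0 (hπ.nonneg i)) (hden i).le) hE0
  have hs1 : ∀ i, s i ≤ 1 := fun i => by
    refine mul_le_one₀ ((div_le_one (hden i)).2 ?_) hE0 hE1
    nlinarith [hr1 i, hr0 i, hπ1 i, hπ.nonneg i]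
  have hfix : ∀ i, s i = p * (μ.real E * π i) + q * (r i * s i) := fun i => by
    have := (hden i).ne'
    simp only [hs]
    field_simp
    ring
  set u : ℕ → Fin K → ℝ := fun l i =>
    μ.real (E ∩ {ω | gridFresh (X · ω) (N · ω) δ (j + l)} ∩ {ω | X ((j + l : ℕ) * δ) ω = i})
    with hu
  have hw : ∀ l i, |μ.real (E ∩ {ω | X ((j + l : ℕ) * δ) ω = i}) - μ.real E * π i| ≤
      C * Real.exp (-(c * (l * δ))) := by
    intro l i
    have hb : 0 ≤ C * Real.exp (-(c * (l * δ))) := mul_nonneg (by linarith) (Real.exp_nonneg _)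
    have hsum := measureReal_eq_sum_inter (μ := μ) (h.source.measurable (j * δ)) E
    rw [h.measureReal_state_add δ hE]
    have : ∑ a, μ.real (E ∩ {ω | X (j * δ) ω = a}) * transition Q (l * δ) a i - μ.real E * π i =
        ∑ a, μ.real (E ∩ {ω | X (j * δ) ω = a}) * (transition Q (l * δ) a i - π i) := by
      simp_rw [mul_sub, Finset.sum_sub_distrib, ← Finset.sum_mul, ← hsum]
    rw [this]
    refine (Finset.abs_sum_le_sum_abs _ _).trans ?_
    calc ∑ a, |μ.real (E ∩ {ω | X (j * δ) ω = a}) * (transition Q (l * δ) a i - π i)|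
        ≤ ∑ a, μ.real (E ∩ {ω | X (j * δ) ω = a}) * (C * Real.exp (-(c * (l * δ)))) := by
          refine Finset.sum_le_sum fun a _ => ?_
          rw [abs_mul, abs_of_nonneg measureReal_nonneg]
          exact mul_le_mul_of_nonneg_left (hmix _ (by positivity) a i) measureReal_nonneg
      _ = μ.real E * (C * Real.exp (-(c * (l * δ)))) := by rw [← Finset.sum_mul, ← hsum]
      _ ≤ 1 * (C * Real.exp (-(c * (l * δ)))) := by gcongr
      _ = _ := one_mul _
  have he : ∀ i, ∀ l, |u l i - s i| ≤ 2 * C * Real.exp (-(c * (l * δ))) := by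
    intro i l
    refine le_two_mul_exp_of_recursion (e := fun l => |u l i - s i|) hC δ.coe_nonneg hc ?_ (fun l => ?_) l
    · have h1 : u 0 i ≤ 1 := measureReal_le_one
      have h0 : 0 ≤ u 0 i := measureReal_nonneg
      exact abs_le.2 ⟨by linarith [hs1 i], by linarith [hs0 i]⟩
    · have hstep : u (l + 1) i = p * μ.real (E ∩ {ω | X ((j + (l + 1) : ℕ) * δ) ω = i}) +
          q * (r i * u l i) :=
        h.measureReal_gridFresh_step δ (gridFiltration_mono X N δ (Nat.le_add_right j l) _ hE) i
      have hdiff : u (l + 1) i - s i =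
          p * (μ.real (E ∩ {ω | X ((j + (l + 1) : ℕ) * δ) ω = i}) - μ.real E * π i) +
            q * (r i * (u l i - s i)) := by
        rw [hstep]
        linear_combination -(hfix i)
      rw [hdiff, ← hqe, ← hpq]
      refine (abs_add_le _ _).trans (add_le_add ?_ ?_)
      · rw [abs_mul, abs_of_nonneg hp0]
        exact mul_le_mul_of_nonneg_left (hw (l + 1) i) hp0
      · rw [abs_mul, abs_of_nonneg hq0, abs_mul, abs_of_nonneg (hr0 i)]
        exact mul_le_mul_of_nonneg_left (mul_le_of_le_one_left (abs_nonneg _) (hr1 i)) hq0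
  have hsplit : μ.real (E ∩ {ω | gridFresh (X · ω) (N · ω) δ (j + l)}) -
      gridMean Q π lam δ * μ.real E = ∑ i, (u l i - s i) := by
    rw [Finset.sum_sub_distrib, gridMean, Finset.sum_mul,
      measureReal_eq_sum_inter (h.source.measurable ((j + l : ℕ) * δ))]
  rw [hsplit]
  refine (Finset.abs_sum_le_sum_abs _ _).trans ((Finset.sum_le_sum fun i _ => he i l).trans ?_)
  simp

theorem gridMean_nonneg (hQ : IsGenerator Q) {π : Fin K → ℝ} (hπ : IsStationary Q π)
    (lam δ : ℝ≥0) : 0 ≤ gridMean Q π lam δ := by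
  refine Finset.sum_nonneg fun i _ => div_nonneg
    (mul_nonneg (cellProb_nonneg _ _ _) (hπ.nonneg i)) (sub_nonneg.2 ?_)
  refine mul_le_one₀ ?_ (transition_nonneg hQ δ.coe_nonneg i i)
    (transition_le_one hQ δ.coe_nonneg i i)
  linarith [cellProb_true lam δ, cellProb_nonneg lam δ true]

theorem gridMean_le_one (hQ : IsGenerator Q) {π : Fin K → ℝ} (hπ : IsStationary Q π)
    (lam δ : ℝ≥0) : gridMean Q π lam δ ≤ 1 := by
  rw [← hπ.sum_eq_one]
  refine Finset.sum_le_sum fun i _ => ?_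
  have hp := cellProb_nonneg lam δ true
  have hq := cellProb_nonneg lam δ false
  have h1 := transition_le_one hQ δ.coe_nonneg i i
  rw [mul_comm, mul_div_assoc]
  refine mul_le_of_le_one_right (hπ.nonneg i) (div_le_one_of_le₀ ?_ ?_) <;>
  · rw [cellProb_true] at *
    nlinarith

/-- Each summand is `π i` times a ratio of difference quotients at `0`: that of `e^{-λt}`, with
derivative `-λ`, over that of `e^{-λt} P_ii(t)`, with derivative `-(λ + σ_i)`. -/
theorem tendsto_gridMean (hQ : IsGenerator Q) {π : Fin K → ℝ} (hπ : IsStationary Q π)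
    (hlam : 0 < lam) :
    Tendsto (fun m : ℕ => gridMean Q π lam (m : ℝ≥0)⁻¹) atTop
      (𝓝 (1 - ∑ i, (π i * exitRate Q i) / (lam + exitRate Q i))) := by
  have hrw : 1 - ∑ i, (π i * exitRate Q i) / (lam + exitRate Q i) =
      ∑ i, lam * π i / (lam + exitRate Q i) := by
    rw [← hπ.sum_eq_one, ← Finset.sum_sub_distrib]
    refine Finset.sum_congr rfl fun i _ => ?_
    have : (lam : ℝ) + exitRate Q i ≠ 0 := (add_pos (by exact_mod_cast hlam) (exitRate_pos hQ i)).ne'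
    field_simp
    ring
  rw [hrw]
  refine tendsto_finsetSum _ fun i _ => ?_
  have hδ : Tendsto (fun m : ℕ => ((m : ℝ))⁻¹) atTop (𝓝[≠] 0) := by
    refine tendsto_nhdsWithin_iff.2 ⟨tendsto_inv_atTop_zero.comp tendsto_natCast_atTop_atTop, ?_⟩
    filter_upwards [eventually_gt_atTop 0] with m hm
    exact inv_ne_zero (Nat.cast_ne_zero.2 hm.ne')
  have hexp : HasDerivAt (fun t : ℝ => Real.exp (-(lam * t))) (-lam) 0 := by
    have := (((hasDerivAt_id (0 : ℝ)).const_mul (lam : ℝ)).neg).exp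
    simpa using this
  have hpr : HasDerivAt (fun t : ℝ => Real.exp (-(lam * t)) * transition Q t i i)
      (-(lam + exitRate Q i)) 0 := by
    refine (hexp.mul (hasDerivAt_transition_apply Q 0 i i)).congr_deriv ?_
    rw [exitRate_eq_neg_diag hQ]
    simp [add_comm]
  have h1 := (hasDerivAt_iff_tendsto_slope.1 hexp).comp hδ
  have h2 := (hasDerivAt_iff_tendsto_slope.1 hpr).comp hδ
  have hne : -((lam : ℝ) + exitRate Q i) ≠ 0 :=
    neg_ne_zero.2 (add_pos (by exact_mod_cast hlam) (exitRate_pos hQ i)).ne'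
  have h3 := (h1.mul_const (π i)).div h2 hne
  have hlimeq : -(lam : ℝ) * π i / -(lam + exitRate Q i) = lam * π i / (lam + exitRate Q i) := by
    rw [neg_mul, neg_div_neg_eq]
  rw [hlimeq] at h3
  refine h3.congr' ?_
  filter_upwards [eventually_gt_atTop 0] with m hm
  have hm' : (m : ℝ) ≠ 0 := Nat.cast_ne_zero.2 hm.ne'
  simp only [slope_def_field, Function.comp_apply, cellProb, transition_zero, mul_zero, neg_zero,
    Real.exp_zero, sub_zero, Matrix.one_apply_eq, mul_one, if_true, Pi.div_apply,
    NNReal.coe_inv, NNReal.coe_natCast, Bool.false_eq_true, if_false]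
  rw [div_mul_eq_mul_div, div_div_div_cancel_right₀ (inv_ne_zero hm'), ← neg_div_neg_eq]
  ring_nf

end Mixing

/-! ### Second moments of sums with geometrically decaying correlations -/

theorem integral_sq_sum_range_le {Ω : Type*} [MeasurableSpace Ω] {μ : Measure Ω}
    [IsProbabilityMeasure μ] {d : ℕ → Ω → ℝ} (hd : ∀ k, Measurable (d k))
    (hbd : ∀ k ω, |d k ω| ≤ 1) {A ρ : ℝ} (hρ0 : 0 ≤ ρ) (hρ1 : ρ < 1)
    (hcov : ∀ j l, |∫ ω, d j ω * d (j + l) ω ∂μ| ≤ A * ρ ^ l) (M : ℕ) :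
    ∫ ω, (∑ k ∈ Finset.range M, d k ω) ^ 2 ∂μ ≤ M * (2 * A / (1 - ρ)) := by
  have hint : ∀ j k, Integrable (fun ω => d j ω * d k ω) μ := fun j k =>
    Integrable.of_bound ((hd j).mul (hd k)).aestronglyMeasurable 1 (ae_of_all _ fun ω => by
      rw [Real.norm_eq_abs, abs_mul]
      exact mul_le_one₀ (hbd j ω) (abs_nonneg _) (hbd k ω))
  have hA : 0 ≤ A := by simpa using (abs_nonneg _).trans (hcov 0 0)
  induction M with
  | zero => simp
  | succ M ih =>
    have hexp : ∀ ω, (∑ k ∈ Finset.range (M + 1), d k ω) ^ 2 =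
        (∑ k ∈ Finset.range M, d k ω) ^ 2 +
          (2 * ∑ k ∈ Finset.range M, d k ω * d M ω + d M ω * d M ω) := fun ω => by
      rw [Finset.sum_range_succ, ← Finset.sum_mul]; ring
    have hi1 : Integrable (fun ω => ∑ k ∈ Finset.range M, d k ω * d M ω) μ :=
      integrable_finsetSum _ fun k _ => hint k M
    have hi2 : Integrable (fun ω => (∑ k ∈ Finset.range M, d k ω) ^ 2) μ := by
      simp_rw [sq, Finset.sum_mul_sum]
      exact integrable_finsetSum _ fun j _ => integrable_finsetSum _ fun k _ => hint j k
    simp_rw [hexp]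
    have hi3 : Integrable
        (fun ω => 2 * ∑ k ∈ Finset.range M, d k ω * d M ω + d M ω * d M ω) μ :=
      (hi1.const_mul 2).add (hint M M)
    rw [integral_add hi2 hi3,
      integral_add (hi1.const_mul 2) (hint M M), integral_const_mul,
      integral_finsetSum _ fun k _ => hint k M]
    -- The range includes `k = M`, so one geometric series covers both the cross terms and the
    -- diagonal term added at this stage.
    have hgeom : ∑ k ∈ Finset.range (M + 1), A * ρ ^ (M - k) ≤ A / (1 - ρ) := by
      rw [← Finset.mul_sum, Finset.sum_flip (f := fun k => ρ ^ k), div_eq_mul_inv]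
      refine mul_le_mul_of_nonneg_left ?_ hA
      rw [← tsum_geometric_of_lt_one hρ0 hρ1]
      exact (summable_geometric_of_lt_one hρ0 hρ1).sum_le_tsum _ fun k _ => by positivity
    have hsum : ∑ k ∈ Finset.range M, ∫ ω, d k ω * d M ω ∂μ ≤
        ∑ k ∈ Finset.range M, A * ρ ^ (M - k) := by
      refine Finset.sum_le_sum fun k hk => (le_abs_self _).trans ?_
      have := hcov k (M - k)
      rwa [Nat.add_sub_cancel' (Finset.mem_range.1 hk).le] at this
    have hlast : ∫ ω, d M ω * d M ω ∂μ ≤ A := by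
      simpa using (le_abs_self _).trans (hcov M 0)
    rw [Finset.sum_range_succ] at hgeom
    simp only [Nat.sub_self, pow_zero, mul_one] at hgeom
    push_cast
    have : (M + 1 : ℝ) * (2 * A / (1 - ρ)) = M * (2 * A / (1 - ρ)) + 2 * (A / (1 - ρ)) := by ring
    rw [this]
    linarith

/-! ### Grid averages -/

section GridFreshness

open Classical in
/-- The grid freshness as a real-valued process. -/
noncomputable def gridFreshness {K : ℕ} {Ω : Type*} (X : ℝ≥0 → Ω → Fin K) (N : ℝ≥0 → Ω → ℕ)
    (δ : ℝ≥0) (k : ℕ) (ω : Ω) : ℝ :=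
  if gridFresh (X · ω) (N · ω) δ k then 1 else 0

variable {K : ℕ} {Ω : Type*} {X : ℝ≥0 → Ω → Fin K} {N : ℝ≥0 → Ω → ℕ}

theorem gridFreshness_eq_indicator (X : ℝ≥0 → Ω → Fin K) (N : ℝ≥0 → Ω → ℕ) (δ : ℝ≥0) (k : ℕ) :
    gridFreshness X N δ k = indicator {ω | gridFresh (X · ω) (N · ω) δ k} 1 := by
  classical
  ext ω
  rw [gridFreshness, indicator_apply]
  rfl

theorem gridFreshness_nonneg (δ : ℝ≥0) (k : ℕ) (ω : Ω) : 0 ≤ gridFreshness X N δ k ω := by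
  rw [gridFreshness]; split_ifs <;> norm_num

theorem gridFreshness_le_one (δ : ℝ≥0) (k : ℕ) (ω : Ω) : gridFreshness X N δ k ω ≤ 1 := by
  rw [gridFreshness]; split_ifs <;> norm_num

end GridFreshness

section GridAverage

variable {K : ℕ} {Ω : Type*} [MeasurableSpace Ω] {Q : Matrix (Fin K) (Fin K) ℝ} {lam : ℝ≥0}
  {X : ℝ≥0 → Ω → Fin K} {N : ℝ≥0 → Ω → ℕ} {μ : Measure Ω}

theorem IsPoissonSampled.measurableSet_gridFresh (h : IsPoissonSampled Q lam X N μ) (δ : ℝ≥0)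
    (k : ℕ) : MeasurableSet {ω | gridFresh (X · ω) (N · ω) δ k} :=
  h.gridFiltration_le δ k (measurableSet_gridFiltration_gridFresh δ k)

theorem IsPoissonSampled.measurable_gridFreshness (h : IsPoissonSampled Q lam X N μ) (δ : ℝ≥0)
    (k : ℕ) : Measurable (gridFreshness X N δ k) := by
  rw [gridFreshness_eq_indicator]
  exact measurable_one.indicator (h.measurableSet_gridFresh δ k)

theorem IsPoissonSampled.integral_gridFreshness (h : IsPoissonSampled Q lam X N μ) (δ : ℝ≥0)
    (k : ℕ) : ∫ ω, gridFreshness X N δ k ω ∂μ = μ.real {ω | gridFresh (X · ω) (N · ω) δ k} := by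
  rw [gridFreshness_eq_indicator, integral_indicator_one (h.measurableSet_gridFresh δ k)]

/-- The grid freshness processes mix exponentially fast, uniformly in the mesh. -/
def IsGridMixing (X : ℝ≥0 → Ω → Fin K) (N : ℝ≥0 → Ω → ℕ) (μ : Measure Ω) (m : ℝ≥0 → ℝ)
    (B c : ℝ) : Prop :=
  ∀ δ : ℝ≥0, 0 < δ → ∀ (j : ℕ) (E : Set Ω), MeasurableSet[gridFiltration X N δ j] E → ∀ l : ℕ,
    |μ.real (E ∩ {ω | gridFresh (X · ω) (N · ω) δ (j + l)}) - m δ * μ.real E| ≤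
      B * Real.exp (-(c * (l * δ)))

variable [IsProbabilityMeasure μ]

theorem IsPoissonSampled.exists_isGridMixing (h : IsPoissonSampled Q lam X N μ)
    (hQ : IsGenerator Q) (hirr : IsIrreducible Q) {π : Fin K → ℝ} (hπ : IsStationary Q π)
    (hlam : 0 < lam) : ∃ B c : ℝ, 0 ≤ B ∧ 0 < c ∧ IsGridMixing X N μ (gridMean Q π lam) B c := by
  obtain ⟨C, c, hC, hc, hmix⟩ := exists_abs_transition_sub_le hQ hirr hπ
  refine ⟨K * (2 * C), min c (lam / 2), by positivity, lt_min hc (by positivity),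
    fun δ hδ j E hE l => ?_⟩
  rw [mul_assoc]
  refine h.abs_measureReal_gridFresh_sub_le hQ hπ hlam hC (min_le_right _ _)
    (fun t ht a i => (hmix t ht a i).trans ?_) hδ hE l
  gcongr
  exact min_le_left _ _

theorem IsGridMixing.abs_measureReal_sub_le {m : ℝ≥0 → ℝ} {B c : ℝ}
    (hmix : IsGridMixing X N μ m B c) {δ : ℝ≥0} (hδ : 0 < δ) (j l : ℕ) :
    |μ.real {ω | gridFresh (X · ω) (N · ω) δ (j + l)} - m δ| ≤ B * Real.exp (-(c * (l * δ))) := by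
  simpa using hmix δ hδ j univ (@MeasurableSet.univ _ (gridFiltration X N δ j)) l

/-- Centring is at the stationary value `m δ`, not at the true mean, so mixing is used twice: once
on the event of being fresh at `j`, once on the whole space. Hence the factor `2`. -/
theorem IsPoissonSampled.abs_integral_mul_le (h : IsPoissonSampled Q lam X N μ) {m : ℝ≥0 → ℝ}
    {B c : ℝ} (hmix : IsGridMixing X N μ m B c) {δ : ℝ≥0} (hδ : 0 < δ) (hm0 : 0 ≤ m δ)
    (hm1 : m δ ≤ 1) (j l : ℕ) :
    |∫ ω, (gridFreshness X N δ j ω - m δ) * (gridFreshness X N δ (j + l) ω - m δ) ∂μ| ≤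
      2 * B * Real.exp (-(c * (l * δ))) := by
  have hint : ∀ k, Integrable (gridFreshness X N δ k) μ := fun k =>
    Integrable.of_bound (h.measurable_gridFreshness δ k).aestronglyMeasurable 1
      (ae_of_all _ fun ω => by
        rw [Real.norm_eq_abs, abs_of_nonneg (gridFreshness_nonneg δ k ω)]
        exact gridFreshness_le_one δ k ω)
  have hprod : (fun ω => gridFreshness X N δ j ω * gridFreshness X N δ (j + l) ω) =
      indicator ({ω | gridFresh (X · ω) (N · ω) δ j} ∩
        {ω | gridFresh (X · ω) (N · ω) δ (j + l)}) 1 := by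
    rw [gridFreshness_eq_indicator, gridFreshness_eq_indicator, inter_indicator_one]
    rfl
  have hmeas : MeasurableSet ({ω | gridFresh (X · ω) (N · ω) δ j} ∩
        {ω | gridFresh (X · ω) (N · ω) δ (j + l)}) :=
    (h.measurableSet_gridFresh δ j).inter (h.measurableSet_gridFresh δ (j + l))
  have hiprod : Integrable
      (fun ω => gridFreshness X N δ j ω * gridFreshness X N δ (j + l) ω) μ := by
    rw [hprod]
    exact (integrable_const (1 : ℝ)).indicator hmeas
  have hval : ∫ ω, (gridFreshness X N δ j ω - m δ) * (gridFreshness X N δ (j + l) ω - m δ) ∂μ =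
      (μ.real ({ω | gridFresh (X · ω) (N · ω) δ j} ∩
        {ω | gridFresh (X · ω) (N · ω) δ (j + l)}) -
          m δ * μ.real {ω | gridFresh (X · ω) (N · ω) δ j}) -
      m δ * (μ.real {ω | gridFresh (X · ω) (N · ω) δ (j + l)} - m δ) := by
    have hexp : ∀ ω, (gridFreshness X N δ j ω - m δ) * (gridFreshness X N δ (j + l) ω - m δ) =
        gridFreshness X N δ j ω * gridFreshness X N δ (j + l) ω - m δ * gridFreshness X N δ j ω -
          (m δ * gridFreshness X N δ (j + l) ω - m δ * m δ) := fun ω => by ring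
    simp_rw [hexp]
    have hi1 : Integrable (fun ω => gridFreshness X N δ j ω * gridFreshness X N δ (j + l) ω -
        m δ * gridFreshness X N δ j ω) μ := hiprod.sub ((hint j).const_mul _)
    have hi2 : Integrable (fun ω => m δ * gridFreshness X N δ (j + l) ω - m δ * m δ) μ :=
      ((hint (j + l)).const_mul _).sub (integrable_const _)
    rw [integral_sub hi1 hi2,
      integral_sub hiprod ((hint j).const_mul _),
      integral_sub ((hint (j + l)).const_mul _) (integrable_const _), integral_const_mul,
      integral_const_mul, h.integral_gridFreshness, h.integral_gridFreshness, hprod,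
      integral_indicator_one hmeas, integral_const, probReal_univ, one_smul]
    ring
  rw [hval]
  have h1 := hmix δ hδ j _ (measurableSet_gridFiltration_gridFresh δ j) l
  have h2 := hmix.abs_measureReal_sub_le hδ j l
  refine (abs_sub _ _).trans ?_
  rw [abs_mul, abs_of_nonneg hm0]
  have h3 := mul_le_of_le_one_left
    (abs_nonneg (μ.real {ω | gridFresh (X · ω) (N · ω) δ (j + l)} - m δ)) hm1
  linarith

/-- Uniform second moment bound for grid averages of the freshness. -/
theorem IsPoissonSampled.integral_sq_gridAverage_le (h : IsPoissonSampled Q lam X N μ)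
    {m : ℝ≥0 → ℝ} {B c : ℝ} (hmix : IsGridMixing X N μ m B c) (hB : 0 ≤ B) (hc : 0 < c)
    (hm0 : ∀ δ, 0 ≤ m δ) (hm1 : ∀ δ, m δ ≤ 1) {n T : ℕ} (hn : 0 < n) (hT : 0 < T) :
    ∫ ω, ((T : ℝ)⁻¹ * ((n : ℝ)⁻¹ *
        ∑ k ∈ Finset.range (T * n), gridFreshness X N (n : ℝ≥0)⁻¹ (k + 1) ω) -
          m (n : ℝ≥0)⁻¹) ^ 2 ∂μ ≤
      4 * B * (1 + c) / c / T := by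
  set δ : ℝ≥0 := (n : ℝ≥0)⁻¹ with hδ
  have hδ0 : 0 < δ := by positivity
  have hδr : (δ : ℝ) = (n : ℝ)⁻¹ := by simp [hδ]
  have hnr : (0 : ℝ) < n := Nat.cast_pos.2 hn
  have hTr : (0 : ℝ) < T := Nat.cast_pos.2 hT
  set ρ := Real.exp (-(c * δ)) with hρ
  have hδ0' : (0 : ℝ) < δ := hδ0
  have hρ1 : ρ < 1 := by
    rw [hρ, Real.exp_lt_one_iff, Left.neg_neg_iff]
    positivity
  have hδ1 : (δ : ℝ) ≤ 1 := by
    rw [hδr]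
    exact inv_le_one_of_one_le₀ (Nat.one_le_cast.2 hn)
  -- This makes the geometric factor `1 / (1 - ρ)` of order `1 / δ = n`, which the averaging over `T
  -- * n` points cancels. The final bound is therefore free of `n`.
  have hgap : c * δ / (1 + c) ≤ 1 - ρ := by
    have h1 : 1 + c * δ ≤ Real.exp (c * δ) := by linarith [Real.add_one_le_exp (c * δ)]
    have h2 : ρ ≤ (1 + c * δ)⁻¹ := by
      rw [hρ, Real.exp_neg]
      exact inv_anti₀ (by positivity) h1
    have h3 : c * δ / (1 + c) ≤ 1 - (1 + c * δ)⁻¹ := by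
      have : 1 - (1 + c * δ)⁻¹ = c * δ / (1 + c * δ) := by
        have : 1 + c * (δ : ℝ) ≠ 0 := by positivity
        field_simp
        ring
      rw [this]
      gcongr
      nlinarith
    linarith
  have hbd : ∀ k ω, |gridFreshness X N δ (k + 1) ω - m δ| ≤ 1 := fun k ω =>
    abs_le.2 ⟨by linarith [gridFreshness_nonneg (X := X) (N := N) δ (k + 1) ω, hm1 δ],
      by linarith [gridFreshness_le_one (X := X) (N := N) δ (k + 1) ω, hm0 δ]⟩
  have key := integral_sq_sum_range_le (μ := μ)
    (d := fun k ω => gridFreshness X N δ (k + 1) ω - m δ)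
    (fun k => (h.measurable_gridFreshness δ (k + 1)).sub_const _) hbd
    (Real.exp_nonneg _) hρ1 (A := 2 * B) (fun j l => by
      have := h.abs_integral_mul_le hmix hδ0 (hm0 δ) (hm1 δ) (j + 1) l
      rw [← Real.exp_nat_mul]
      convert this using 4
      · ring_nf
      · ring) (T * n)
  have heq : ∀ ω, ((T : ℝ)⁻¹ * ((n : ℝ)⁻¹ *
        ∑ k ∈ Finset.range (T * n), gridFreshness X N δ (k + 1) ω) - m δ) ^ 2 =
      ((T : ℝ) * n)⁻¹ ^ 2 *
        (∑ k ∈ Finset.range (T * n), (gridFreshness X N δ (k + 1) ω - m δ)) ^ 2 := by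
    intro ω
    rw [Finset.sum_sub_distrib, Finset.sum_const, Finset.card_range, nsmul_eq_mul, ← mul_pow]
    push_cast
    field_simp
  simp_rw [heq]
  rw [integral_const_mul]
  calc ((T : ℝ) * n)⁻¹ ^ 2 *
        ∫ ω, (∑ k ∈ Finset.range (T * n), (gridFreshness X N δ (k + 1) ω - m δ)) ^ 2 ∂μ
      ≤ ((T : ℝ) * n)⁻¹ ^ 2 * ((T * n : ℕ) * (2 * (2 * B) / (c * δ / (1 + c)))) := by
        refine mul_le_mul_of_nonneg_left (key.trans ?_) (by positivity)
        gcongr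
    _ = 4 * B * (1 + c) / c / T := by
        rw [hδr]
        push_cast
        field_simp
        ring

end GridAverage

/-! ### From sums to integrals, and from square times to all times -/

theorem integral_natCeil_mul (a : ℕ → ℝ) (T : ℕ) {n : ℕ} (hn : 0 < n) :
    ∫ t in (0 : ℝ)..T, a ⌈t.toNNReal * n⌉₊ =
      (n : ℝ)⁻¹ * ∑ k ∈ Finset.range (T * n), a (k + 1) := by
  have hnr : (0 : ℝ) < n := Nat.cast_pos.2 hn
  -- Rounding up reads each cell at its right end, which is why the sums run over `a (k + 1)`.
  have hcell : ∀ k : ℕ, ∀ t ∈ Ioc ((k : ℝ) / n) ((k + 1 : ℕ) / n), ⌈t.toNNReal * n⌉₊ = k + 1 := by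
    intro k t ht
    have ht0 : 0 ≤ t := le_trans (by positivity) ht.1.le
    rw [Nat.ceil_eq_iff k.succ_ne_zero, Nat.succ_sub_one, ← NNReal.coe_lt_coe,
      ← NNReal.coe_le_coe]
    simp only [NNReal.coe_mul, NNReal.coe_natCast, Real.coe_toNNReal t ht0]
    exact ⟨(div_lt_iff₀ hnr).1 ht.1, (le_div_iff₀ hnr).1 ht.2⟩
  have hle : ∀ k : ℕ, (k : ℝ) / n ≤ (k + 1 : ℕ) / n := fun k => by gcongr; exact k.le_succ
  have hae : ∀ k : ℕ, ∀ t ∈ uIoc ((k : ℝ) / n) ((k + 1 : ℕ) / n),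
      a ⌈t.toNNReal * n⌉₊ = a (k + 1) := fun k t ht => by
    rw [uIoc_of_le (hle k)] at ht
    rw [hcell k t ht]
  have hint : ∀ k < T * n, IntervalIntegrable (fun t : ℝ => a ⌈t.toNNReal * n⌉₊) volume
      ((k : ℝ) / n) ((k + 1 : ℕ) / n) := fun k _ =>
    (intervalIntegrable_const (c := a (k + 1))).congr fun t ht => (hae k t ht).symm
  have hsum := intervalIntegral.sum_integral_adjacent_intervals
    (a := fun k : ℕ => (k : ℝ) / n) hint
  have hT : ((T * n : ℕ) : ℝ) / n = T := by push_cast; field_simp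
  simp only [Nat.cast_zero, zero_div, hT] at hsum
  rw [← hsum, Finset.mul_sum]
  refine Finset.sum_congr rfl fun k _ => ?_
  rw [intervalIntegral.integral_congr_ae (ae_of_all _ (hae k)),
    intervalIntegral.integral_const, smul_eq_mul]
  push_cast
  ring

/-- A square-integrable sequence with summable second moments tends to zero almost surely. -/
theorem ae_tendsto_zero_of_summable_integral_sq {Ω : Type*} [MeasurableSpace Ω]
    {μ : Measure Ω} {J : ℕ → Ω → ℝ} (hJ : ∀ n, Measurable (J n))
    (hi : ∀ n, Integrable (fun ω => J n ω ^ 2) μ) {a : ℕ → ℝ} (ha : Summable a)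
    (hle : ∀ n, ∫ ω, J n ω ^ 2 ∂μ ≤ a n) : ∀ᵐ ω ∂μ, Tendsto (fun n => J n ω) atTop (𝓝 0) := by
  have hmeas : ∀ n, Measurable fun ω => ENNReal.ofReal (J n ω ^ 2) := fun n =>
    ((hJ n).pow_const 2).ennreal_ofReal
  have ha0 : ∀ n, 0 ≤ a n := fun n => (integral_nonneg fun ω => sq_nonneg _).trans (hle n)
  have hfin : ∫⁻ ω, ∑' n, ENNReal.ofReal (J n ω ^ 2) ∂μ ≠ ∞ := by
    rw [lintegral_tsum fun n => (hmeas n).aemeasurable]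
    refine ne_top_of_le_ne_top (ha.tsum_ofReal_ne_top) (ENNReal.tsum_le_tsum fun n => ?_)
    rw [← ofReal_integral_eq_lintegral_ofReal (hi n) (ae_of_all _ fun ω => sq_nonneg _)]
    exact ENNReal.ofReal_le_ofReal (hle n)
  filter_upwards [ae_lt_top (Measurable.tsum hmeas) hfin] with ω hω
  have h0 := ENNReal.tendsto_atTop_zero_of_tsum_ne_top hω.ne
  have h1 : Tendsto (fun n => J n ω ^ 2) atTop (𝓝 0) := by
    have := (ENNReal.tendsto_toReal ENNReal.zero_ne_top).comp h0
    refine this.congr fun n => ?_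
    rw [Function.comp_apply, ENNReal.toReal_ofReal (sq_nonneg _)]
  have h2 := h1.sqrt
  rw [Real.sqrt_zero] at h2
  exact (tendsto_zero_iff_abs_tendsto_zero _).2 (h2.congr fun n => Real.sqrt_sq_eq_abs _)

/-- Ratios of consecutive squares tend to `1`, so a monotone function is squeezed between its values
at squares; floors and ceilings then pass from integers to real times. -/
theorem tendsto_inv_mul_of_tendsto_sq {I : ℝ → ℝ} (hmono : MonotoneOn I (Ici 0)) {f : ℝ}
    (hlim : Tendsto (fun n : ℕ => I ((n + 1) ^ 2 : ℕ) / ((n + 1) ^ 2 : ℕ)) atTop (𝓝 f)) :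
    Tendsto (fun T : ℝ => T⁻¹ * I T) atTop (𝓝 f) := by
  have hnat : Tendsto (fun n : ℕ => I n / n) atTop (𝓝 f) := by
    refine tendsto_div_of_monotone_of_exists_subseq_tendsto_div (fun n => I n) f
      (fun m n hmn => hmono (mem_Ici.2 m.cast_nonneg) (mem_Ici.2 n.cast_nonneg)
        (Nat.cast_le.2 hmn)) fun a ha => ⟨fun n => (n + 1) ^ 2, ?_, ?_, hlim⟩
    · have h1 : Tendsto (fun n : ℕ => (1 + 1 / ((n : ℝ) + 1)) ^ 2) atTop (𝓝 ((1 + 0) ^ 2)) :=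
        (tendsto_const_nhds.add tendsto_one_div_add_atTop_nhds_zero_nat).pow 2
      rw [add_zero, one_pow] at h1
      filter_upwards [h1.eventually_lt_const ha] with n hn
      have hpos : (0 : ℝ) < n + 1 := by positivity
      push_cast
      have : ((n : ℝ) + 1 + 1) ^ 2 = (1 + 1 / ((n : ℝ) + 1)) ^ 2 * (n + 1) ^ 2 := by
        field_simp
      rw [this]
      exact mul_le_mul_of_nonneg_right hn.le (sq_nonneg _)
    · exact (tendsto_pow_atTop two_ne_zero).comp (tendsto_add_atTop_nat 1)
  have hfloor : Tendsto (fun T : ℝ => ((⌊T⌋₊ : ℝ) / T)) atTop (𝓝 1) :=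
    tendsto_nat_floor_div_atTop
  have hceil : Tendsto (fun T : ℝ => ((⌈T⌉₊ : ℝ) / T)) atTop (𝓝 1) :=
    tendsto_nat_ceil_div_atTop
  have hlow := (hnat.comp (tendsto_nat_floor_atTop (α := ℝ))).mul hfloor
  have hup := (hnat.comp (tendsto_nat_ceil_atTop (α := ℝ))).mul hceil
  rw [mul_one] at hlow hup
  refine tendsto_of_tendsto_of_tendsto_of_le_of_le' hlow hup ?_ ?_
  · filter_upwards [eventually_ge_atTop (1 : ℝ)] with T hT
    have hf : (0 : ℝ) < ⌊T⌋₊ := Nat.cast_pos.2 (Nat.floor_pos.2 hT)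
    have hT0 : 0 < T := by linarith
    rw [Function.comp_apply, div_mul_div_cancel₀ hf.ne', div_eq_inv_mul]
    exact mul_le_mul_of_nonneg_left
      (hmono (mem_Ici.2 hf.le) (mem_Ici.2 hT0.le) (Nat.floor_le hT0.le)) (inv_nonneg.2 hT0.le)
  · filter_upwards [eventually_ge_atTop (1 : ℝ)] with T hT
    have hT0 : 0 < T := by linarith
    have hf : (0 : ℝ) < ⌈T⌉₊ := Nat.cast_pos.2 (Nat.ceil_pos.2 hT0)
    rw [Function.comp_apply, div_mul_div_cancel₀ hf.ne', div_eq_inv_mul]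
    exact mul_le_mul_of_nonneg_left
      (hmono (mem_Ici.2 hT0.le) (mem_Ici.2 hf.le) (Nat.le_ceil T)) (inv_nonneg.2 hT0.le)

/-! ### Continuous time with initially stale information -/

section StaleStart

variable {K : ℕ} {Ω : Type*} {X : ℝ≥0 → Ω → Fin K} {N : ℝ≥0 → Ω → ℕ} {b : Ω → Bool}

theorem freshness_nonneg (t : ℝ≥0) (ω : Ω) : 0 ≤ freshness X N b t ω := by
  rw [freshness]; split_ifs <;> norm_num

theorem freshness_le_one (t : ℝ≥0) (ω : Ω) : freshness X N b t ω ≤ 1 := by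
  rw [freshness]; split_ifs <;> norm_num

theorem freshness_eq_one_iff (t : ℝ≥0) (ω : Ω) :
    freshness X N b t ω = 1 ↔ IsFresh (X · ω) (N · ω) (b ω) t := by
  rw [freshness]; split_ifs with h <;> simp [h]

theorem measurable_gridFreshness_natCeil (n : ℕ) (ω : Ω) :
    Measurable fun t : ℝ => gridFreshness X N (n : ℝ≥0)⁻¹ ⌈t.toNNReal * n⌉₊ ω := by
  have h1 : Measurable fun t : ℝ => ⌈t.toNNReal * n⌉₊ :=
    Nat.measurable_ceil.comp (measurable_real_toNNReal.mul_const _)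
  exact (measurable_from_nat (f := fun k => gridFreshness X N (n : ℝ≥0)⁻¹ k ω)).comp h1

variable [MeasurableSpace Ω] {Q : Matrix (Fin K) (Fin K) ℝ} {lam : ℝ≥0} {μ : Measure Ω}

theorem IsPoissonSampled.tendsto_gridFreshness (h : IsPoissonSampled Q lam X N μ) (t : ℝ≥0)
    (ω : Ω) :
    Tendsto (fun n : ℕ => gridFreshness X N (n : ℝ≥0)⁻¹ ⌈t * n⌉₊ ω) atTop
      (𝓝 (freshness X N (fun _ => false) t ω)) := by
  refine tendsto_const_nhds.congr' ?_
  filter_upwards [eventually_gridFresh_iff (h.source.rightContinuous ω) (h.sampler.monotone ω)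
    (h.sampler.rightContinuous ω) t] with n hn
  rw [freshness, gridFreshness]
  classical exact if_congr hn.symm rfl rfl

/-- Freshness refers to uncountably many times; measurability comes from its being a pointwise limit
of grid processes. -/
theorem IsPoissonSampled.measurable_freshness (h : IsPoissonSampled Q lam X N μ) (t : ℝ≥0) :
    Measurable (freshness X N (fun _ => false) t) :=
  measurable_of_tendsto_metrizable (fun _ => h.measurable_gridFreshness _ _)
    (tendsto_pi_nhds.2 fun ω => h.tendsto_gridFreshness t ω)

theorem IsPoissonSampled.measurable_freshness_path (h : IsPoissonSampled Q lam X N μ) (ω : Ω) :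
    Measurable fun t : ℝ => freshness X N (fun _ => false) t.toNNReal ω :=
  measurable_of_tendsto_metrizable (fun n => measurable_gridFreshness_natCeil n ω)
    (tendsto_pi_nhds.2 fun t => h.tendsto_gridFreshness t.toNNReal ω)

theorem IsPoissonSampled.intervalIntegrable_freshness_path (h : IsPoissonSampled Q lam X N μ)
    (ω : Ω) (s t : ℝ) :
    IntervalIntegrable (fun t => freshness X N (fun _ => false) t.toNNReal ω) volume s t :=
  (intervalIntegrable_const (c := (1 : ℝ))).mono_fun
    (h.measurable_freshness_path ω).aestronglyMeasurable (ae_of_all _ fun u => by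
      dsimp only
      rw [Real.norm_eq_abs, abs_of_nonneg (freshness_nonneg _ _), norm_one]
      exact freshness_le_one _ _)

theorem IsPoissonSampled.tendsto_grid_integral (h : IsPoissonSampled Q lam X N μ) (T : ℕ)
    (ω : Ω) :
    Tendsto (fun n : ℕ => (n : ℝ)⁻¹ *
        ∑ k ∈ Finset.range (T * n), gridFreshness X N (n : ℝ≥0)⁻¹ (k + 1) ω) atTop
      (𝓝 (∫ t in (0 : ℝ)..T, freshness X N (fun _ => false) t.toNNReal ω)) := by
  have hlim : Tendsto (fun n : ℕ => ∫ t in (0 : ℝ)..T,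
      gridFreshness X N (n : ℝ≥0)⁻¹ ⌈t.toNNReal * n⌉₊ ω) atTop
      (𝓝 (∫ t in (0 : ℝ)..T, freshness X N (fun _ => false) t.toNNReal ω)) := by
    refine intervalIntegral.tendsto_integral_filter_of_dominated_convergence (fun _ => 1)
      (Eventually.of_forall fun n => (measurable_gridFreshness_natCeil n ω).aestronglyMeasurable)
      (Eventually.of_forall fun n => ae_of_all _ fun t _ => ?_) intervalIntegrable_const
      (ae_of_all _ fun t _ => h.tendsto_gridFreshness t.toNNReal ω)
    rw [Real.norm_eq_abs, abs_of_nonneg (gridFreshness_nonneg _ _ _)]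
    exact gridFreshness_le_one _ _ _
  refine hlim.congr' ?_
  filter_upwards [eventually_gt_atTop 0] with n hn
  exact integral_natCeil_mul (fun k => gridFreshness X N (n : ℝ≥0)⁻¹ k ω) T hn

theorem IsPoissonSampled.measurable_integral_freshness (h : IsPoissonSampled Q lam X N μ)
    (T : ℕ) :
    Measurable fun ω => ∫ t in (0 : ℝ)..T, freshness X N (fun _ => false) t.toNNReal ω :=
  measurable_of_tendsto_metrizable (fun n => measurable_const.mul
    (Finset.measurable_sum _ fun k _ => h.measurable_gridFreshness (n : ℝ≥0)⁻¹ (k + 1)))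
    (tendsto_pi_nhds.2 fun ω => h.tendsto_grid_integral T ω)

variable [IsProbabilityMeasure μ]

/-- The bound for grid averages does not involve the mesh, so it survives the limit under dominated
convergence. -/
theorem IsPoissonSampled.integral_sq_timeAverage_le (h : IsPoissonSampled Q lam X N μ)
    {m : ℝ≥0 → ℝ} {B c f : ℝ} (hmix : IsGridMixing X N μ m B c) (hB : 0 ≤ B) (hc : 0 < c)
    (hm0 : ∀ δ, 0 ≤ m δ) (hm1 : ∀ δ, m δ ≤ 1)
    (hm : Tendsto (fun n : ℕ => m (n : ℝ≥0)⁻¹) atTop (𝓝 f)) {T : ℕ} (hT : 0 < T) :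
    ∫ ω, ((T : ℝ)⁻¹ * (∫ t in (0 : ℝ)..T, freshness X N (fun _ => false) t.toNNReal ω) - f) ^ 2 ∂μ
      ≤ 4 * B * (1 + c) / c / T := by
  set Z : ℕ → Ω → ℝ := fun n ω => (T : ℝ)⁻¹ * ((n : ℝ)⁻¹ *
        ∑ k ∈ Finset.range (T * n), gridFreshness X N (n : ℝ≥0)⁻¹ (k + 1) ω) -
          m (n : ℝ≥0)⁻¹ with hZ
  have hbd : ∀ n ω, |Z n ω| ≤ 1 := by
    intro n ω
    set s := ∑ k ∈ Finset.range (T * n), gridFreshness X N (n : ℝ≥0)⁻¹ (k + 1) ω with hs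
    have hs0 : 0 ≤ s := Finset.sum_nonneg fun k _ => gridFreshness_nonneg _ _ _
    have hs1 : s ≤ T * n := by
      refine (Finset.sum_le_sum fun k _ => gridFreshness_le_one _ _ _).trans ?_
      simp
    have h1 : (T : ℝ)⁻¹ * ((n : ℝ)⁻¹ * s) ≤ 1 := by
      rw [← mul_assoc, ← mul_inv]
      exact inv_mul_le_one_of_le₀ hs1 (by positivity)
    have h0 : 0 ≤ (T : ℝ)⁻¹ * ((n : ℝ)⁻¹ * s) := by positivity
    exact abs_le.2 ⟨by linarith [hm1 (n : ℝ≥0)⁻¹], by linarith [hm0 (n : ℝ≥0)⁻¹]⟩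
  have hmeas : ∀ n, Measurable (Z n) := fun n => (measurable_const.mul (measurable_const.mul
    (Finset.measurable_sum _ fun k _ => h.measurable_gridFreshness (n : ℝ≥0)⁻¹ (k + 1)))).sub_const _
  have hlim := tendsto_integral_of_dominated_convergence (μ := μ) (F := fun n ω => Z n ω ^ 2)
    (fun _ => (1 : ℝ)) (fun n => ((hmeas n).pow_const 2).aestronglyMeasurable)
    (integrable_const _) (fun n => ae_of_all _ fun ω => by
      rw [Real.norm_eq_abs, abs_of_nonneg (sq_nonneg _)]
      exact (sq_le_one_iff_abs_le_one _).2 (hbd n ω))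
    (ae_of_all _ fun ω => (((h.tendsto_grid_integral T ω).const_mul _).sub hm).pow 2)
  refine le_of_tendsto hlim ?_
  filter_upwards [eventually_gt_atTop 0] with n hn
  exact h.integral_sq_gridAverage_le hmix hB hc hm0 hm1 hn hT

theorem IsPoissonSampled.abs_measureReal_freshness_sub_le (h : IsPoissonSampled Q lam X N μ)
    {m : ℝ≥0 → ℝ} {B c f : ℝ} (hmix : IsGridMixing X N μ m B c) (hB : 0 ≤ B) (hc : 0 < c)
    (hm : Tendsto (fun n : ℕ => m (n : ℝ≥0)⁻¹) atTop (𝓝 f)) (t : ℝ≥0) :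
    |μ.real {ω | freshness X N (fun _ => false) t ω = 1} - f| ≤ B * Real.exp (-(c * t)) := by
  have hval : ∫ ω, freshness X N (fun _ => false) t ω ∂μ =
      μ.real {ω | freshness X N (fun _ => false) t ω = 1} := by
    have hind : freshness X N (fun _ => false) t =
        indicator {ω | freshness X N (fun _ => false) t ω = 1} 1 := by
      ext ω
      rw [indicator_apply]
      split_ifs with h1
      · exact h1
      · have := mt (freshness_eq_one_iff t ω).2 h1
        rw [freshness, if_neg this]
    conv_lhs => rw [hind]
    exact integral_indicator_one (h.measurable_freshness t (measurableSet_singleton 1))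
  have hlim := tendsto_integral_of_dominated_convergence (μ := μ)
    (F := fun n ω => gridFreshness X N (n : ℝ≥0)⁻¹ ⌈t * n⌉₊ ω) (fun _ => (1 : ℝ))
    (fun n => (h.measurable_gridFreshness _ _).aestronglyMeasurable)
    (integrable_const _) (fun n => ae_of_all _ fun ω => by
      rw [Real.norm_eq_abs, abs_of_nonneg (gridFreshness_nonneg _ _ _)]
      exact gridFreshness_le_one _ _ _)
    (ae_of_all _ fun ω => h.tendsto_gridFreshness t ω)
  rw [hval] at hlim
  refine le_of_tendsto (hlim.sub hm).abs ?_
  filter_upwards [eventually_gt_atTop 0] with n hn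
  have hnr : (0 : ℝ) < n := Nat.cast_pos.2 hn
  -- Mixing is counted from time `0`; rounding `t` up to the grid only improves the exponential
  -- bound.
  have := hmix.abs_measureReal_sub_le (δ := (n : ℝ≥0)⁻¹) (by positivity) 0 ⌈t * n⌉₊
  rw [zero_add] at this
  rw [h.integral_gridFreshness]
  refine this.trans ?_
  have hceil : (t : ℝ) ≤ ⌈t * n⌉₊ * ((n : ℝ≥0)⁻¹ : ℝ≥0) := by
    rw [NNReal.coe_inv, NNReal.coe_natCast, ← div_eq_mul_inv, le_div_iff₀ hnr]
    exact_mod_cast Nat.le_ceil (t * (n : ℝ≥0))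
  gcongr

theorem IsPoissonSampled.ae_tendsto_timeAverage (h : IsPoissonSampled Q lam X N μ)
    {m : ℝ≥0 → ℝ} {B c f : ℝ} (hmix : IsGridMixing X N μ m B c) (hB : 0 ≤ B) (hc : 0 < c)
    (hm0 : ∀ δ, 0 ≤ m δ) (hm1 : ∀ δ, m δ ≤ 1)
    (hm : Tendsto (fun n : ℕ => m (n : ℝ≥0)⁻¹) atTop (𝓝 f)) :
    ∀ᵐ ω ∂μ, Tendsto (fun T : ℝ => T⁻¹ *
      ∫ t in (0 : ℝ)..T, freshness X N (fun _ => false) t.toNNReal ω) atTop (𝓝 f) := by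
  set I : ℝ → Ω → ℝ := fun T ω => ∫ t in (0 : ℝ)..T, freshness X N (fun _ => false) t.toNNReal ω
    with hI
  have hI0 : ∀ T ω, 0 ≤ T → 0 ≤ I T ω := fun T ω hT =>
    intervalIntegral.integral_nonneg hT fun t _ => freshness_nonneg _ _
  have hI1 : ∀ T ω, 0 ≤ T → I T ω ≤ T := fun T ω hT => by
    have := intervalIntegral.integral_mono_on hT (h.intervalIntegrable_freshness_path ω 0 T)
      (intervalIntegrable_const (c := (1 : ℝ))) fun t _ => freshness_le_one _ _
    simpa using this
  have hmeas : ∀ T : ℕ, Measurable fun ω => (T : ℝ)⁻¹ * I T ω - f := fun T =>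
    ((h.measurable_integral_freshness T).const_mul _).sub_const f
  have hinteg : ∀ T : ℕ, Integrable (fun ω => ((T : ℝ)⁻¹ * I T ω - f) ^ 2) μ := fun T => by
    refine Integrable.of_bound ((hmeas T).pow_const 2).aestronglyMeasurable ((1 + |f|) ^ 2)
      (ae_of_all _ fun ω => ?_)
    rw [Real.norm_eq_abs, abs_of_nonneg (sq_nonneg _), sq_le_sq, abs_of_nonneg (a := 1 + |f|)
      (by positivity)]
    refine (abs_sub _ _).trans (add_le_add_left ?_ _)
    have h0 := hI0 T ω T.cast_nonneg
    rw [abs_of_nonneg (by positivity)]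
    exact inv_mul_le_one_of_le₀ (hI1 T ω T.cast_nonneg) T.cast_nonneg
  -- A bound of order `1 / T` is not summable over all integers `T`, but it is along squares. The
  -- shift `n + 1` avoids `T = 0`.
  have hsum : Summable fun n : ℕ => 4 * B * (1 + c) / c / ((n + 1) ^ 2 : ℕ) := by
    have h1 := (summable_nat_add_iff 1).2 (Real.summable_one_div_nat_pow.2 one_lt_two)
    refine (h1.mul_left (4 * B * (1 + c) / c)).congr fun n => ?_
    push_cast
    ring
  have hae := ae_tendsto_zero_of_summable_integral_sq (μ := μ)
    (J := fun n ω => (((n + 1) ^ 2 : ℕ) : ℝ)⁻¹ * I ((n + 1) ^ 2 : ℕ) ω - f)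
    (fun n => hmeas _) (fun n => hinteg _) hsum
    (fun n => h.integral_sq_timeAverage_le hmix hB hc hm0 hm1 hm (by positivity))
  filter_upwards [hae] with ω hω
  refine tendsto_inv_mul_of_tendsto_sq (I := fun T => I T ω) (fun s hs t ht hst => ?_) ?_
  · have := intervalIntegral.integral_add_adjacent_intervals
      (h.intervalIntegrable_freshness_path ω 0 s) (h.intervalIntegrable_freshness_path ω s t)
    have h0 : 0 ≤ ∫ t in s..t, freshness X N (fun _ => false) t.toNNReal ω :=
      intervalIntegral.integral_nonneg hst fun t _ => freshness_nonneg _ _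
    simp only [hI]
    linarith
  · have := hω.add_const f
    simp only [sub_add_cancel, zero_add] at this
    refine this.congr fun n => ?_
    rw [div_eq_inv_mul]

end StaleStart

/-! ### Removing the initial bit -/

section InitialBit

variable {K : ℕ}

theorem IsFresh.of_false {x : ℝ≥0 → Fin K} {n : ℝ≥0 → ℕ} {b : Bool} {t : ℝ≥0}
    (h : IsFresh x n false t) : IsFresh x n b t := by
  rcases h with h | ⟨h, -⟩
  · exact Or.inl h
  · exact absurd h (by simp)

/-- If the counter has moved, a sample lies in `(0, t]`; a source without transitions on `(0, t]`
has none after that sample either. -/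
theorem IsFresh.to_false {x : ℝ≥0 → Fin K} {n : ℝ≥0 → ℕ} {b : Bool} {t : ℝ≥0}
    (h : IsFresh x n b t) (hnr : ∀ t, ContinuousWithinAt n (Ici t) t) (hn : n 0 ≠ n t) :
    IsFresh x n false t := by
  rcases h with h | ⟨-, h⟩
  · exact Or.inl h
  · obtain ⟨s, hs, hj⟩ : ∃ s ∈ Ioc 0 t, JumpsAt n s := by
      by_contra! hcon
      exact hn ((forall_not_jumpsAt_iff hnr).1 hcon t ⟨zero_le, le_rfl⟩).symm
    exact Or.inl ⟨s, hs.2, hj, fun u hu => h u ⟨hs.1.trans hu.1, hu.2⟩⟩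

variable {Ω : Type*} [MeasurableSpace Ω] {Q : Matrix (Fin K) (Fin K) ℝ} {lam : ℝ≥0}
  {X : ℝ≥0 → Ω → Fin K} {N : ℝ≥0 → Ω → ℕ} {μ : Measure Ω}

theorem IsPoissonProcess.measureReal_eq_zero (h : IsPoissonProcess lam N μ) (t : ℝ≥0) :
    μ.real {ω | N t ω = 0} = Real.exp (-(lam * t)) := by
  have := h.measureReal_cell t 0 false
  simpa [cellProb, h.zero] using this

theorem IsPoissonProcess.ae_exists_pos [IsProbabilityMeasure μ] (h : IsPoissonProcess lam N μ)
    (hlam : 0 < lam) : ∀ᵐ ω ∂μ, ∃ T : ℝ≥0, 0 < N T ω := by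
  have hle : ∀ n : ℕ, μ.real {ω | ¬ ∃ T : ℝ≥0, 0 < N T ω} ≤ Real.exp (-(lam * (n : ℝ))) := by
    intro n
    have h1 := h.measureReal_eq_zero n
    rw [NNReal.coe_natCast] at h1
    rw [← h1]
    refine measureReal_mono fun ω hω => ?_
    have := not_exists.1 hω (n : ℝ≥0)
    exact Nat.eq_zero_of_not_pos this
  have hlim : Tendsto (fun n : ℕ => Real.exp (-(lam * (n : ℝ)))) atTop (𝓝 0) :=
    Real.tendsto_exp_neg_atTop_nhds_zero.comp
      (tendsto_natCast_atTop_atTop.const_mul_atTop (by exact_mod_cast hlam))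
  have h0 : μ.real {ω | ¬ ∃ T : ℝ≥0, 0 < N T ω} = 0 :=
    le_antisymm (ge_of_tendsto' hlim hle) measureReal_nonneg
  rw [ae_iff]
  exact (measureReal_eq_zero_iff).1 h0

theorem IsPoissonSampled.freshness_eq_of_pos (h : IsPoissonSampled Q lam X N μ) (b : Ω → Bool)
    {t : ℝ≥0} {ω : Ω} (hN : 0 < N t ω) :
    freshness X N b t ω = freshness X N (fun _ => false) t ω := by
  have hne : N 0 ω ≠ N t ω := by rw [h.sampler.zero]; exact hN.ne
  have hiff : IsFresh (X · ω) (N · ω) (b ω) t ↔ IsFresh (X · ω) (N · ω) false t :=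
    ⟨fun hf => hf.to_false (h.sampler.rightContinuous ω) hne, IsFresh.of_false⟩
  rw [freshness, freshness]
  classical exact if_congr hiff rfl rfl

/-- The initial bit adds only the times before which the source has not moved. They form an
order-connected set, hence a measurable one. -/
theorem IsPoissonSampled.measurable_freshness_path_bit (h : IsPoissonSampled Q lam X N μ)
    (b : Ω → Bool) (ω : Ω) : Measurable fun t : ℝ => freshness X N b t.toNNReal ω := by
  set A : Set ℝ := {t | ∀ u ∈ Ioc 0 t.toNNReal, ¬ JumpsAt (X · ω) u} with hA
  have hAm : MeasurableSet A := by
    refine OrdConnected.measurableSet ⟨fun s hs t ht u hu => ?_⟩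
    exact fun v hv => ht v ⟨hv.1, hv.2.trans (Real.toNNReal_le_toNNReal hu.2)⟩
  have hset : (fun t : ℝ => freshness X N b t.toNNReal ω) = fun t : ℝ =>
      max (freshness X N (fun _ => false) t.toNNReal ω)
        (({t | b ω = true} ∩ A).indicator (fun _ => (1 : ℝ)) t) := by
    ext t
    have hiff : IsFresh (X · ω) (N · ω) (b ω) t.toNNReal ↔
        IsFresh (X · ω) (N · ω) false t.toNNReal ∨ t ∈ {t : ℝ | b ω = true} ∩ A := by
      simp [IsFresh, hA]
    by_cases h2 : t ∈ {t : ℝ | b ω = true} ∩ A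
    · rw [indicator_of_mem h2, max_eq_right (freshness_le_one _ _), freshness_eq_one_iff]
      exact hiff.2 (Or.inr h2)
    · rw [indicator_of_notMem h2, max_eq_left (freshness_nonneg _ _), freshness, freshness]
      classical exact if_congr (hiff.trans (or_iff_left h2)) rfl rfl
  rw [hset]
  exact (h.measurable_freshness_path ω).max
    (measurable_const.indicator ((MeasurableSet.const _).inter hAm))

theorem IsPoissonSampled.intervalIntegrable_freshness_path_bit (h : IsPoissonSampled Q lam X N μ)
    (b : Ω → Bool) (ω : Ω) (s t : ℝ) :
    IntervalIntegrable (fun t => freshness X N b t.toNNReal ω) volume s t :=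
  (intervalIntegrable_const (c := (1 : ℝ))).mono_fun
    (h.measurable_freshness_path_bit b ω).aestronglyMeasurable (ae_of_all _ fun u => by
      dsimp only
      rw [Real.norm_eq_abs, abs_of_nonneg (freshness_nonneg _ _), norm_one]
      exact freshness_le_one _ _)

theorem IsPoissonSampled.hasMeanFreshness [IsProbabilityMeasure μ]
    (h : IsPoissonSampled Q lam X N μ) (hQ : IsGenerator Q) (hirr : IsIrreducible Q)
    {π : Fin K → ℝ} (hπ : IsStationary Q π) (hlam : 0 < lam) (b : Ω → Bool) :
    HasMeanFreshness μ (freshness X N b)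
      (1 - ∑ i, (π i * exitRate Q i) / (lam + exitRate Q i)) := by
  obtain ⟨B, c, hB, hc, hmix⟩ := h.exists_isGridMixing hQ hirr hπ hlam
  have hm := tendsto_gridMean hQ hπ hlam
  constructor
  · filter_upwards [h.ae_tendsto_timeAverage hmix hB hc (gridMean_nonneg hQ hπ lam)
      (gridMean_le_one hQ hπ lam) hm, h.sampler.ae_exists_pos hlam] with ω hω hpos
    obtain ⟨T₀, hT₀⟩ := hpos
    -- After `T₀` the two freshness paths coincide, so their integrals differ by the constant `D`,
    -- which disappears after division by `T`.
    set D : ℝ := (∫ t in (0 : ℝ)..T₀, freshness X N b t.toNNReal ω) -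
      ∫ t in (0 : ℝ)..T₀, freshness X N (fun _ => false) t.toNNReal ω with hD
    have hlim := (tendsto_inv_atTop_zero.mul_const D).add hω
    rw [zero_mul, zero_add] at hlim
    refine hlim.congr' ?_
    filter_upwards [eventually_ge_atTop (T₀ : ℝ)] with T hT
    have h1 := intervalIntegral.integral_add_adjacent_intervals
      (h.intervalIntegrable_freshness_path_bit b ω 0 T₀)
      (h.intervalIntegrable_freshness_path_bit b ω T₀ T)
    have h2 := intervalIntegral.integral_add_adjacent_intervals
      (h.intervalIntegrable_freshness_path ω 0 T₀)
      (h.intervalIntegrable_freshness_path ω T₀ T)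
    have h3 : ∫ t in (T₀ : ℝ)..T, freshness X N b t.toNNReal ω =
        ∫ t in (T₀ : ℝ)..T, freshness X N (fun _ => false) t.toNNReal ω := by
      refine intervalIntegral.integral_congr fun t ht => ?_
      rw [uIcc_of_le hT] at ht
      exact h.freshness_eq_of_pos b
        (hT₀.trans_le (h.sampler.monotone ω (NNReal.le_toNNReal_of_coe_le ht.1)))
    rw [← mul_add, ← h1, ← h2, h3, hD]
    ring
  · have hlim0 : Tendsto (fun t : ℝ≥0 => μ.real {ω | freshness X N (fun _ => false) t ω = 1}) atTop
        (𝓝 (1 - ∑ i, (π i * exitRate Q i) / (lam + exitRate Q i))) := by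
      rw [tendsto_iff_dist_tendsto_zero]
      refine squeeze_zero (fun _ => dist_nonneg)
        (fun t => h.abs_measureReal_freshness_sub_le hmix hB hc hm t) ?_
      have := (Real.tendsto_exp_neg_atTop_nhds_zero.comp
        (NNReal.tendsto_coe_atTop.2 tendsto_id |>.const_mul_atTop hc)).const_mul B
      simpa using this
    have hN0 : Tendsto (fun t : ℝ≥0 => μ.real {ω | N t ω = 0}) atTop (𝓝 0) := by
      simp_rw [h.sampler.measureReal_eq_zero]
      exact Real.tendsto_exp_neg_atTop_nhds_zero.comp
        (NNReal.tendsto_coe_atTop.2 tendsto_id |>.const_mul_atTop (by exact_mod_cast hlam))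
    have hup := hlim0.add hN0
    rw [add_zero] at hup
    -- An initially fresh bit can only add freshness, and only while no sample has been taken.
    refine tendsto_of_tendsto_of_tendsto_of_le_of_le hlim0 hup (fun t => ?_) (fun t => ?_)
    · refine measureReal_mono fun ω hω => ?_
      exact (freshness_eq_one_iff t ω).2 ((freshness_eq_one_iff t ω).1 hω).of_false
    · refine (measureReal_mono fun ω hω => ?_).trans (measureReal_union_le _ _)
      rcases Nat.eq_zero_or_pos (N t ω) with h0 | h0
      · exact Or.inr h0
      · refine Or.inl ?_
        have : freshness X N b t ω = 1 := hω
        rwa [h.freshness_eq_of_pos b h0] at this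

end InitialBit

/-! ### Analytic properties of the formula -/

section MeanFreshness

variable {K : ℕ} {π σ : Fin K → ℝ}

/-- The mean freshness with state weights `π` and exit rates `σ`, as a function of the rate. -/
noncomputable def meanFreshness (π σ : Fin K → ℝ) (lam : ℝ) : ℝ :=
  1 - ∑ i, π i * σ i / (lam + σ i)

theorem exists_pos_of_sum_eq_one (h0 : ∀ i, 0 ≤ π i) (h1 : ∑ i, π i = 1) : ∃ i, 0 < π i := by
  by_contra! hcon
  have : ∑ i, π i = 0 := Finset.sum_eq_zero fun i _ => le_antisymm (hcon i) (h0 i)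
  linarith

theorem strictMonoOn_meanFreshness (h0 : ∀ i, 0 ≤ π i) (h1 : ∑ i, π i = 1) (hσ : ∀ i, 0 < σ i) :
    StrictMonoOn (meanFreshness π σ) (Ioi 0) := by
  intro x hx y hy hxy
  obtain ⟨i, hi⟩ := exists_pos_of_sum_eq_one h0 h1
  rw [mem_Ioi] at hx hy
  refine sub_lt_sub_left (Finset.sum_lt_sum (fun j _ => ?_) ⟨i, Finset.mem_univ i, ?_⟩) 1
  · have := h0 j
    have := hσ j
    gcongr
  · have := hσ i
    gcongr

theorem inv_convex_combination_lt {x y a b : ℝ} (hx : 0 < x) (hy : 0 < y) (hxy : x ≠ y)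
    (ha : 0 < a) (hb : 0 < b) (hab : a + b = 1) : (a * x + b * y)⁻¹ < a * x⁻¹ + b * y⁻¹ := by
  have h := (strictConvexOn_zpow (m := -1) (by norm_num) (by norm_num)).2
    (mem_Ioi.2 hx) (mem_Ioi.2 hy) hxy ha hb hab
  simpa using h

/-- Each `1 / (λ + σ_i)` is strictly convex and enters with the weight `-π_i σ_i ≤ 0`. Strictness
needs one nonzero weight, supplied by a state with `π_i > 0`. -/
theorem strictConcaveOn_meanFreshness (h0 : ∀ i, 0 ≤ π i) (h1 : ∑ i, π i = 1)
    (hσ : ∀ i, 0 < σ i) : StrictConcaveOn ℝ (Ioi 0) (meanFreshness π σ) := by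
  refine ⟨convex_Ioi 0, fun x hx y hy hxy a b ha hb hab => ?_⟩
  obtain ⟨i, hi⟩ := exists_pos_of_sum_eq_one h0 h1
  rw [mem_Ioi] at hx hy
  have hinv : ∀ j, (a * x + b * y + σ j)⁻¹ < a * (x + σ j)⁻¹ + b * (y + σ j)⁻¹ := fun j => by
    have := inv_convex_combination_lt (add_pos hx (hσ j)) (add_pos hy (hσ j))
      (fun h => hxy (add_right_cancel h)) ha hb hab
    have he : a * x + b * y + σ j = a * (x + σ j) + b * (y + σ j) := by
      linear_combination -(σ j) * hab
    rwa [he]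
  have hlt : ∑ j, π j * σ j / (a * x + b * y + σ j) <
      ∑ j, π j * σ j * (a * (x + σ j)⁻¹ + b * (y + σ j)⁻¹) := by
    simp_rw [div_eq_mul_inv]
    refine Finset.sum_lt_sum (fun j _ => ?_) ⟨i, Finset.mem_univ i, ?_⟩
    · exact mul_le_mul_of_nonneg_left (hinv j).le (mul_nonneg (h0 j) (hσ j).le)
    · exact mul_lt_mul_of_pos_left (hinv i) (mul_pos hi (hσ i))
  have hsum : ∑ j, π j * σ j * (a * (x + σ j)⁻¹ + b * (y + σ j)⁻¹) =
      a * ∑ j, π j * σ j / (x + σ j) + b * ∑ j, π j * σ j / (y + σ j) := by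
    rw [Finset.mul_sum, Finset.mul_sum, ← Finset.sum_add_distrib]
    exact Finset.sum_congr rfl fun j _ => by ring
  simp only [meanFreshness, smul_eq_mul]
  rw [hsum] at hlt
  linarith

theorem contDiffOn_meanFreshness (hσ : ∀ i, 0 < σ i) :
    ContDiffOn ℝ 1 (meanFreshness π σ) (Ioi 0) := by
  refine contDiffOn_const.sub (ContDiffOn.sum fun i _ => contDiffOn_const.div
    (contDiffOn_id.add contDiffOn_const) fun x hx => ?_)
  exact (add_pos hx (hσ i)).ne'

/-- Since every `σ i` is positive, the formula is continuous at `0`, where each summand reduces to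
`π i`. -/
theorem tendsto_meanFreshness_zero (h1 : ∑ i, π i = 1) (hσ : ∀ i, 0 < σ i) :
    Tendsto (meanFreshness π σ) (𝓝[>] 0) (𝓝 0) := by
  have hc : ContinuousAt (meanFreshness π σ) 0 := by
    refine continuousAt_const.sub (tendsto_finsetSum _ fun i _ => ?_)
    refine ContinuousAt.div continuousAt_const (continuousAt_id.add continuousAt_const) ?_
    simpa using (hσ i).ne'
  have hz : meanFreshness π σ 0 = 0 := by
    rw [meanFreshness, ← h1, sub_eq_zero]
    refine Finset.sum_congr rfl fun i _ => ?_
    rw [zero_add, mul_div_cancel_right₀ _ (hσ i).ne']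
  have := hc.tendsto.mono_left (nhdsWithin_le_nhds (s := Ioi 0))
  rwa [hz] at this

end MeanFreshness

end PoissonSampling

/-! ### The theorem -/

open PoissonSampling in
theorem theorem4 {K : ℕ} (Q : Matrix (Fin K) (Fin K) ℝ) (hQ : IsGenerator Q)
    (hirr : IsIrreducible Q) (π : Fin K → ℝ) (hπ : IsStationary Q π) :
    ∃ f : ℝ → ℝ,
      (∀ lam : ℝ≥0, 0 < lam →
        ∀ (Ω : Type*) [MeasurableSpace Ω] (μ : Measure Ω) [IsProbabilityMeasure μ]
          (X : ℝ≥0 → Ω → Fin K) (N : ℝ≥0 → Ω → ℕ) (b : Ω → Bool),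
          IsPoissonSampled Q lam X N μ → Measurable b →
            HasMeanFreshness μ (freshness X N b) (f lam)) ∧
      (∀ lam : ℝ, 0 < lam → f lam = 1 - ∑ i, (π i * exitRate Q i) / (lam + exitRate Q i)) ∧
      StrictMonoOn f (Ioi 0) ∧
      StrictConcaveOn ℝ (Ioi 0) f ∧
      DifferentiableOn ℝ f (Ioi 0) ∧
      ContinuousOn (deriv f) (Ioi 0) ∧
      Tendsto f (𝓝[>] 0) (𝓝 0) := by
  have hσ := exitRate_pos hQ
  have hdiff := contDiffOn_meanFreshness (π := π) hσ
  exact ⟨meanFreshness π (exitRate Q),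
    fun lam hlam Ω _ μ _ X N b h _ => h.hasMeanFreshness hQ hirr hπ hlam b,
    fun lam _ => rfl,
    strictMonoOn_meanFreshness hπ.nonneg hπ.sum_eq_one hσ,
    strictConcaveOn_meanFreshness hπ.nonneg hπ.sum_eq_one hσ,
    hdiff.differentiableOn one_ne_zero,
    hdiff.continuousOn_deriv_of_isOpen isOpen_Ioi le_rfl,
    tendsto_meanFreshness_zero hπ.sum_eq_one hσ⟩
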